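/- Let $(\Omega,\mathcal F,P)$ be a probability space, $L^0(\mathcal F)$ the algebra of equivalence classes (modulo a.s. equality) of real random variables, and $\bar L^0(\mathcal F)$ the complete lattice of equivalence classes of $[-\infty,+\infty]$-valued random variables, ordered by $\xi\le\eta$ a.s.; $\tilde I_A$ is the class of the indicator of $A\in\mathcal F$, $0\cdot(\pm\infty)=0$, $+\infty\pm(\pm\infty)=+\infty$, and "on $A$" means "a.s. on $A$". Let $(E,\mathcal P)$ be a random locally convex module over $\mathbb R$ with base $(\Omega,\mathcal F,P)$: $E$ is an $L^0(\mathcal F)$-module and $\mathcal P$ is a family of maps $\|\cdot\|:E\to L^0(\mathcal F)$ with $\|x\|\ge 0$, $\|\xi x\|=|\xi|\,\|x\|$ and $\|x+y\|\le\|x\|+\|y\|$ for $\xi\in L^0(\mathcal F)$, $x,y\in E$, such that $\|x\|=0$ for all $\|\cdot\|\in\mathcal P$ only if $x=0$. The locally $L^0$-convex topology $\mathcal T_c$ on $E$ has at each $x$ the neighbourhood base $\{y:\|y-x\|\le\varepsilon\ \forall\,\|\cdot\|\in\mathcal Q\}$, with $\mathcal Q\subset\mathcal P$ finite and $\varepsilon\in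 L^0(\mathcal F)$, $\varepsilon>0$ a.s.; on $L^0(\mathcal F)$, $\mathcal T_c$ is the topology so induced by $|\cdot|$. $E_c^*$ is the set of continuous $L^0(\mathcal F)$-module homomorphisms $(E,\mathcal T_c)\to(L^0(\mathcal F),\mathcal T_c)$. $E$ has the countable concatenation property if for every countable partition $\{A_n\}\subset\mathcal F$ of $\Omega$ and every sequence $(x_n)$ in $E$ there is $x\in E$ with $\tilde I_{A_n}x=\tilde I_{A_n}x_n$ for all $n$. A function $f:E\to\bar L^0(\mathcal F)$ is local if $\tilde I_Af(x)=\tilde I_Af(\tilde I_Ax)$ for all $x\in E$, $A\in\mathcal F$. Put $$f_c^*(g)=\bigvee_{x\in E}\bigl(g(x)-f(x)\bigr)\ (g\in E_c^*),\qquad f_c^{**}(x)=\bigvee_{g\in E_c^*}\bigl(g(x)-f_c^*(g)\bigr)\ (x\in E).$$ Let $MI(f)$ be the essential supremum of the events $A$ such that $f(x)=-\infty$ on $A$ for some $x\in E$, $PI(f)$ the essential supremum of the events $A$ such that $f(x)=+\infty$ on $A$ for all $x\in E$, and $BP(f)=\Omega\setminus(MI(f)\cup PI(f))$. For $A\in\mathcal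 F$ let $E^A=\tilde I_AE$ and $f_A=\tilde I_Af|_{E^A}$. The function $f_A$ is proper if $f_A(x)<+\infty$ on $A$ for some $x\in E^A$ and $f_A(x)>-\infty$ on $A$ for all $x\in E^A$; it is $L^0$-convex if $f_A(\xi x+(1-\xi)y)\le\xi f_A(x)+(1-\xi)f_A(y)$ on $A$ for all $x,y\in E^A$ and $\xi\in L^0(\mathcal F)$ with $0\le\xi\le1$; it is $\mathcal T_c$-lower semicontinuous if $\{(x,r)\in E^A\times\tilde I_AL^0(\mathcal F): f_A(x)\le r\}$ is closed in $E^A\times\tilde I_AL^0(\mathcal F)$ for $\mathcal T_c$. A local function $f$ is $\mathcal T_c$-closed if $f(x)=-\infty$ on $MI(f)$ for all $x\in E$, and $f_A$ is $L^0$-convex and $\mathcal T_c$-lower semicontinuous for every $A\in\mathcal F$ with $A\subset BP(f)$ and $P(A)>0$ for which $f_A$ is proper. The $\mathcal T_c$-closure $Cl_c(f)$ is the greatest $\mathcal T_c$-closed function $h$ with $h(x)\le f(x)$ for all $x\in E$. **Corollary 5.15.** If $E$ has the countable concatenation property and $f:E\to\bar L^0(\mathcal F)$ is a local function, then the greatest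 $\mathcal T_c$-closed function majorized by $f$ exists and is the biconjugate: $f_c^{**}=Cl_c(f)$. -/

import Mathlib

open MeasureTheory Filter
open scoped Topology

noncomputable section

namespace RandomConvex

/-- `L⁰(ℱ)`: equivalence classes of real random variables. -/
abbrev L0 {Ω : Type*} [MeasurableSpace Ω] (μ : Measure Ω) : Type _ := Ω →ₘ[μ] ℝ

/-- `L̄⁰(ℱ)`: equivalence classes of extended real random variables, ordered a.s. -/
abbrev LBar0 {Ω : Type*} [MeasurableSpace Ω] (μ : Measure Ω) : Type _ := Ω →ₘ[μ] EReal

section Basic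

variable {Ω : Type*} [MeasurableSpace Ω] {μ : Measure Ω}

/-- `L⁰(ℱ)` with its a.s. pointwise operations is a commutative ring; all operations are those
already defined for `Ω →ₘ[μ] ℝ`. -/
instance instCommRingL0 : CommRing (Ω →ₘ[μ] ℝ) :=
  { (AEEqFun.instAddCommGroup : AddCommGroup (Ω →ₘ[μ] ℝ)),
    (AEEqFun.instCommMonoid : CommMonoid (Ω →ₘ[μ] ℝ)) with
    left_distrib := by
      intro a b c
      apply AEEqFun.ext
      filter_upwards [AEEqFun.coeFn_mul a (b + c), AEEqFun.coeFn_add b c,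
        AEEqFun.coeFn_add (a * b) (a * c), AEEqFun.coeFn_mul a b, AEEqFun.coeFn_mul a c]
        with ω h1 h2 h3 h4 h5
      simp only [h1, h2, h3, h4, h5, Pi.mul_apply, Pi.add_apply, mul_add]
    right_distrib := by
      intro a b c
      apply AEEqFun.ext
      filter_upwards [AEEqFun.coeFn_mul (a + b) c, AEEqFun.coeFn_add a b,
        AEEqFun.coeFn_add (a * c) (b * c), AEEqFun.coeFn_mul a c, AEEqFun.coeFn_mul b c]
        with ω h1 h2 h3 h4 h5
      simp only [h1, h2, h3, h4, h5, Pi.mul_apply, Pi.add_apply, add_mul]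
    zero_mul := by
      intro a
      apply AEEqFun.ext
      filter_upwards [AEEqFun.coeFn_mul 0 a, AEEqFun.coeFn_zero (μ := μ) (β := ℝ)] with ω h1 h2
      simp only [h1, h2, Pi.mul_apply, Pi.zero_apply, zero_mul]
    mul_zero := by
      intro a
      apply AEEqFun.ext
      filter_upwards [AEEqFun.coeFn_mul a 0, AEEqFun.coeFn_zero (μ := μ) (β := ℝ)] with ω h1 h2
      simp only [h1, h2, Pi.mul_apply, Pi.zero_apply, mul_zero] }

/-- The class of the characteristic function of `A ∈ ℱ`. -/
def ind (A : Set Ω) (hA : MeasurableSet A) : L0 μ :=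
  AEEqFun.mk (A.indicator fun _ => (1 : ℝ))
    ((measurable_const.indicator hA).aestronglyMeasurable)

theorem measurable_coe_sub : Measurable (Function.uncurry fun (a : ℝ) (b : EReal) =>
    (a : EReal) - b) := by
  have h : Measurable fun p : ℝ × EReal => (p.1 : EReal) + (-p.2) :=
    (measurable_coe_real_ereal.comp measurable_fst).add
      (continuous_neg.measurable.comp measurable_snd)
  exact h

/-- The difference `ξ - η` of `ξ ∈ L⁰(ℱ)` and `η ∈ L̄⁰(ℱ)`; no `∞ - ∞` can occur. -/
def subBar (ξ : L0 μ) (η : LBar0 μ) : LBar0 μ :=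
  AEEqFun.comp₂Measurable (fun (a : ℝ) (b : EReal) => (a : EReal) - b) measurable_coe_sub ξ η

/-- `ξ > 0 on Ω`, that is, `ξ ∈ L⁰₊₊(ℱ)`. -/
def IsPosOn (ξ : L0 μ) : Prop := ∀ᵐ ω ∂μ, 0 < ξ ω

/-- A countable partition of `Ω` to `ℱ`. -/
structure IsPartition (A : ℕ → Set Ω) : Prop where
  measurable : ∀ n, MeasurableSet (A n)
  disjoint : Pairwise (Function.onFun Disjoint A)
  iUnion_eq : ⋃ n, A n = Set.univ

/-- Addition on `[-∞, +∞]` with the convention `(+∞) + (-∞) = +∞`. -/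
def addTop (a b : EReal) : EReal := if a = ⊤ ∨ b = ⊤ then ⊤ else a + b

/-- A family of events has a countable subfamily whose union contains each member a.s. -/
theorem exists_countable_cover [IsFiniteMeasure μ] {ι : Type*} (S : Set ι) (U : ι → Set Ω)
    (hU : ∀ i, MeasurableSet (U i)) :
    ∃ C : Set ι, C ⊆ S ∧ C.Countable ∧ ∀ i ∈ S, ∀ᵐ ω ∂μ, ω ∈ U i → ω ∈ ⋃ c ∈ C, U c := by
  classical
  let V : Set ENNReal := {m | ∃ C : Set ι, C ⊆ S ∧ C.Countable ∧ m = μ (⋃ c ∈ C, U c)}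
  have hV : V.Nonempty := ⟨_, ∅, Set.empty_subset _, Set.countable_empty, rfl⟩
  obtain ⟨u, -, hu, huV⟩ := exists_seq_tendsto_sSup hV (OrderTop.bddAbove V)
  choose C hCS hCc hCu using huV
  have hc : (⋃ n, C n).Countable := Set.countable_iUnion hCc
  have hs : (⋃ n, C n) ⊆ S := Set.iUnion_subset hCS
  have hmax : sSup V ≤ μ (⋃ c ∈ ⋃ n, C n, U c) := by
    refine le_of_tendsto' hu fun n => ?_
    rw [hCu n]
    exact measure_mono (Set.biUnion_subset_biUnion_left (Set.subset_iUnion C n))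
  refine ⟨⋃ n, C n, hs, hc, fun i hi => ?_⟩
  set W := ⋃ c ∈ ⋃ n, C n, U c with hW
  have hWm : MeasurableSet W := MeasurableSet.biUnion hc fun c _ => hU c
  have h1 : μ (U i ∪ W) ≤ μ W := by
    refine le_trans (le_sSup ?_) hmax
    refine ⟨insert i (⋃ n, C n), Set.insert_subset hi hs, hc.insert i, ?_⟩
    rw [Set.biUnion_insert]
  have h2 : W =ᵐ[μ] (U i ∪ W : Set Ω) :=
    ae_eq_of_subset_of_measure_ge Set.subset_union_right h1 hWm.nullMeasurableSet
      (measure_ne_top _ _)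
  filter_upwards [h2.mem_iff] with ω hω hi'
  exact hω.2 (Or.inl hi')

/-- `L̄⁰(ℱ)` is a complete lattice: every subset has a supremum. -/
theorem exists_isLUB [IsFiniteMeasure μ] (S : Set (LBar0 μ)) : ∃ s, IsLUB S s := by
  have hm : ∀ ζ : LBar0 μ, Measurable ζ := fun ζ => ζ.stronglyMeasurable.measurable
  choose C hCS hCc hC using fun q : ℚ =>
    exists_countable_cover (μ := μ) S (fun ζ : LBar0 μ => {ω | ((q : ℝ) : EReal) < ζ ω})
      fun ζ => measurableSet_lt measurable_const (hm ζ)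
  have hc : (⋃ q, C q).Countable := Set.countable_iUnion hCc
  have hmeas : Measurable fun ω => ⨆ ζ ∈ ⋃ q, C q, ζ ω :=
    Measurable.biSup _ hc fun ζ _ => hm ζ
  refine ⟨AEEqFun.mk _ hmeas.aestronglyMeasurable, fun ζ hζ => ?_, fun b hb => ?_⟩
  · rw [← AEEqFun.coeFn_le]
    have hall : ∀ᵐ ω ∂μ, ∀ q : ℚ, ((q : ℝ) : EReal) < ζ ω →
        ω ∈ ⋃ c ∈ C q, {ω | ((q : ℝ) : EReal) < c ω} :=
      ae_all_iff.2 fun q => hC q ζ hζ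
    filter_upwards [hall, AEEqFun.coeFn_mk _ hmeas.aestronglyMeasurable (μ := μ)] with ω h1 h2
    rw [h2]
    refine le_of_forall_lt fun a ha => ?_
    obtain ⟨q, hq1, hq2⟩ := EReal.lt_iff_exists_rat_btwn.1 ha
    obtain ⟨c, hcC, hcq⟩ := Set.mem_iUnion₂.1 (h1 q hq2)
    exact hq1.trans (lt_of_lt_of_le hcq
      (le_iSup₂_of_le (f := fun (ζ : LBar0 μ) (_ : ζ ∈ ⋃ q, C q) => ζ ω) c
        (Set.mem_iUnion.2 ⟨q, hcC⟩) le_rfl))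
  · rw [← AEEqFun.coeFn_le]
    have hall : ∀ᵐ ω ∂μ, ∀ ζ ∈ ⋃ q, C q, ζ ω ≤ b ω := by
      rw [ae_ball_iff hc]
      intro ζ hζ
      obtain ⟨q, hq⟩ := Set.mem_iUnion.1 hζ
      exact AEEqFun.coeFn_le.2 (hb (hCS q hq))
    filter_upwards [hall, AEEqFun.coeFn_mk _ hmeas.aestronglyMeasurable (μ := μ)] with ω h1 h2
    rw [h2]
    exact iSup₂_le h1

/-- The supremum `⋁ S` of a subset `S` of the complete lattice `L̄⁰(ℱ)`. -/
def esup [IsFiniteMeasure μ] (S : Set (LBar0 μ)) : LBar0 μ := (exists_isLUB S).choose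

theorem isLUB_esup [IsFiniteMeasure μ] (S : Set (LBar0 μ)) : IsLUB S (esup S) :=
  (exists_isLUB S).choose_spec

/-- `M` is (a representative of) the essential supremum of the family of events `H`: the least
event, up to null sets, that contains all members of `H` up to null sets. -/
structure IsEssSupSet (μ : Measure Ω) (H : Set (Set Ω)) (M : Set Ω) : Prop where
  measurable : MeasurableSet M
  subset : ∀ A ∈ H, ∀ᵐ ω ∂μ, ω ∈ A → ω ∈ M
  least : ∀ B, MeasurableSet B → (∀ A ∈ H, ∀ᵐ ω ∂μ, ω ∈ A → ω ∈ B) → ∀ᵐ ω ∂μ, ω ∈ M → ω ∈ B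

theorem exists_isEssSupSet [IsFiniteMeasure μ] (H : Set (Set Ω))
    (hH : ∀ A ∈ H, MeasurableSet A) : ∃ M, IsEssSupSet μ H M := by
  obtain ⟨C, -, hCc, hC⟩ := exists_countable_cover (μ := μ) (Set.univ : Set H)
    (fun A : H => (A : Set Ω)) fun A => hH A A.2
  refine ⟨⋃ c ∈ C, (c : Set Ω), MeasurableSet.biUnion hCc fun c _ => hH c c.2,
    fun A hA => hC ⟨A, hA⟩ trivial, fun B _ hB => ?_⟩
  have hall : ∀ᵐ ω ∂μ, ∀ c ∈ C, ω ∈ (c : Set Ω) → ω ∈ B :=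
    (ae_ball_iff hCc).2 fun c _ => hB c c.2
  filter_upwards [hall] with ω h1 h2
  obtain ⟨c, hc, hω⟩ := Set.mem_iUnion₂.1 h2
  exact h1 c hc hω

/-- The essential supremum of a family of events (determined up to a null set). -/
def essSupSet [IsFiniteMeasure μ] (H : Set (Set Ω)) (hH : ∀ A ∈ H, MeasurableSet A) : Set Ω :=
  (exists_isEssSupSet (μ := μ) H hH).choose

theorem isEssSupSet_essSupSet [IsFiniteMeasure μ] (H : Set (Set Ω))
    (hH : ∀ A ∈ H, MeasurableSet A) : IsEssSupSet μ H (essSupSet (μ := μ) H hH) :=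
  (exists_isEssSupSet (μ := μ) H hH).choose_spec

end Basic

section Modules

variable {Ω : Type*} [MeasurableSpace Ω] {μ : Measure Ω}
variable {E : Type*} [AddCommGroup E] [Module (Ω →ₘ[μ] ℝ) E]

/-- An `L⁰`-seminorm on the `L⁰(ℱ)`-module `E`. -/
structure IsL0Seminorm (p : E → L0 μ) : Prop where
  nonneg : ∀ x, 0 ≤ p x
  smul : ∀ (ξ : L0 μ) (x : E), p (ξ • x) = |ξ| * p x
  add_le : ∀ x y, p (x + y) ≤ p x + p y

/-- `(E, 𝒫)` is a random locally convex module over `ℝ` with base `(Ω, ℱ, μ)`. -/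
structure IsRLCModule (P : Set (E → L0 μ)) : Prop where
  seminorm : ∀ p ∈ P, IsL0Seminorm p
  separating : ∀ x : E, (∀ p ∈ P, p x = 0) ↔ x = 0

/-- The subset `G` of `E` has the countable concatenation property. -/
def HasCCP (G : Set E) : Prop :=
  ∀ (A : ℕ → Set Ω) (hA : IsPartition A) (x : ℕ → E), (∀ n, x n ∈ G) →
    ∃ y ∈ G, ∀ n, (ind (A n) (hA.measurable n) : L0 μ) • y =
      (ind (A n) (hA.measurable n) : L0 μ) • x n

/-- The locally `L⁰`-convex topology `𝒯_c` induced by `𝒫`: the sets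
`{y | ‖y - x‖_Q ≤ ε}` (`Q ⊆ 𝒫` finite, `ε ∈ L⁰₊₊`) form a neighbourhood base at `x`. Since
`‖·‖_Q = ⋁ {‖·‖ : ‖·‖ ∈ Q}` and `ε ≥ 0`, the inequality says `‖y - x‖ ≤ ε` for all `‖·‖ ∈ Q`. -/
@[reducible] def tc (P : Set (E → L0 μ)) : TopologicalSpace E where
  IsOpen G := ∀ x ∈ G, ∃ (Q : Set (E → L0 μ)) (ε : L0 μ), Q ⊆ P ∧ Q.Finite ∧ IsPosOn ε ∧
    {y : E | ∀ p ∈ Q, p (y - x) ≤ ε} ⊆ G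
  isOpen_univ := by
    intro x _
    refine ⟨∅, 1, Set.empty_subset _, Set.finite_empty, ?_, Set.subset_univ _⟩
    filter_upwards [AEEqFun.coeFn_one (μ := μ) (β := ℝ)] with ω hω
    rw [hω]
    exact one_pos
  isOpen_inter := by
    intro G H hG hH x hx
    obtain ⟨Q, ε, hQ, hQf, hε, hs⟩ := hG x hx.1
    obtain ⟨R, δ, hR, hRf, hδ, ht⟩ := hH x hx.2
    refine ⟨Q ∪ R, ε ⊓ δ, Set.union_subset hQ hR, hQf.union hRf, ?_, fun y hy => ⟨?_, ?_⟩⟩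
    · filter_upwards [AEEqFun.coeFn_inf ε δ, hε, hδ] with ω h1 h2 h3
      rw [h1]
      exact lt_min h2 h3
    · exact hs fun p hp => (hy p (Or.inl hp)).trans inf_le_left
    · exact ht fun p hp => (hy p (Or.inr hp)).trans inf_le_right
  isOpen_sUnion := by
    intro S hS x hx
    obtain ⟨G, hG, hxG⟩ := hx
    obtain ⟨Q, ε, hQ, hQf, hε, hs⟩ := hS G hG x hxG
    exact ⟨Q, ε, hQ, hQf, hε, hs.trans (Set.subset_sUnion_of_mem hG)⟩

variable (μ) in
/-- The topology `𝒯_c` of `L⁰(ℱ)`, induced by its random norm `|·|`. -/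
@[reducible] def tcL0 : TopologicalSpace (L0 μ) := tc {fun ξ : L0 μ => |ξ|}

/-- The random conjugate space `E_c^*`: continuous module homomorphisms from `(E, 𝒯_c)` to
`(L⁰(ℱ), 𝒯_c)`. -/
def DualC (P : Set (E → L0 μ)) : Type _ :=
  {g : E →ₗ[Ω →ₘ[μ] ℝ] (Ω →ₘ[μ] ℝ) // Continuous[tc P, tcL0 μ] g}

/-- `f` is local: `I_A f(x) = I_A f(I_A x)`, i.e. `f(x) = f(I_A x)` a.s. on `A`. -/
def IsLocal (f : E → LBar0 μ) : Prop :=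
  ∀ (x : E) (A : Set Ω) (hA : MeasurableSet A),
    ∀ᵐ ω ∂μ, ω ∈ A → f x ω = f ((ind A hA : L0 μ) • x) ω

/-- The `𝒯_c`-conjugate `f_c^*(g) = ⋁ {g(x) - f(x) | x ∈ E}`. -/
def conjC [IsFiniteMeasure μ] (P : Set (E → L0 μ)) (f : E → LBar0 μ) (g : DualC P) : LBar0 μ :=
  esup (Set.range fun x : E => subBar (g.1 x) (f x))

/-- The `𝒯_c`-biconjugate `f_c^{**}(x) = ⋁ {g(x) - f_c^*(g) | g ∈ E_c^*}`. -/
def biconjC [IsFiniteMeasure μ] (P : Set (E → L0 μ)) (f : E → LBar0 μ) (x : E) : LBar0 μ :=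
  esup (Set.range fun g : DualC P => subBar (g.1 x) (conjC P f g))

/-- The events on which `f` takes the value `-∞` at some point of `E`. -/
def eventsMI (f : E → LBar0 μ) : Set (Set Ω) :=
  {A | MeasurableSet A ∧ ∃ x : E, ∀ᵐ ω ∂μ, ω ∈ A → f x ω = ⊥}

/-- The events on which `f` is identically `+∞`. -/
def eventsPI (f : E → LBar0 μ) : Set (Set Ω) :=
  {A | MeasurableSet A ∧ ∀ x : E, ∀ᵐ ω ∂μ, ω ∈ A → f x ω = ⊤}

/-- `MI(f)`. -/
def MI [IsFiniteMeasure μ] (f : E → LBar0 μ) : Set Ω :=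
  essSupSet (μ := μ) (eventsMI f) fun _ h => h.1

/-- `PI(f)`. -/
def PI [IsFiniteMeasure μ] (f : E → LBar0 μ) : Set Ω :=
  essSupSet (μ := μ) (eventsPI f) fun _ h => h.1

/-- `BP(f) = Ω \ (MI(f) ∪ PI(f))`. -/
def BP [IsFiniteMeasure μ] (f : E → LBar0 μ) : Set Ω := (MI f ∪ PI f)ᶜ

variable (μ E) in
/-- The stratum `E^A = I_A E`. For `E = L⁰(ℱ)` it is `I_A L⁰(ℱ)`, identified with `L⁰(A ∩ ℱ)`. -/
def stratum (A : Set Ω) (hA : MeasurableSet A) : Set E :=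
  Set.range fun x : E => (ind A hA : L0 μ) • x

/-- `f_A : E^A → I_A L̄⁰(ℱ)`, `f_A(x) = I_A f(x)`, is proper. Elements of `I_A L̄⁰(ℱ)` are compared
by comparing them on `A`. -/
def ProperOn (f : E → LBar0 μ) (A : Set Ω) (hA : MeasurableSet A) : Prop :=
  (∃ x ∈ stratum μ E A hA, ∀ᵐ ω ∂μ, ω ∈ A → f x ω < ⊤) ∧
    ∀ x ∈ stratum μ E A hA, ∀ᵐ ω ∂μ, ω ∈ A → ⊥ < f x ω

/-- `f_A` is `L⁰(A ∩ ℱ)`-convex (with `0 · (±∞) = 0` and `+∞ + (-∞) = +∞`). -/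
def ConvexOnEvent (f : E → LBar0 μ) (A : Set Ω) (hA : MeasurableSet A) : Prop :=
  ∀ x ∈ stratum μ E A hA, ∀ y ∈ stratum μ E A hA, ∀ ξ : L0 μ, 0 ≤ ξ → ξ ≤ 1 →
    ∀ᵐ ω ∂μ, ω ∈ A → f (ξ • x + (1 - ξ) • y) ω ≤
      addTop ((ξ ω : EReal) * f x ω) (((1 - ξ ω : ℝ) : EReal) * f y ω)

/-- The epigraph of `f_A` in `E^A × I_A L⁰(ℱ)`. -/
def epiOn (f : E → LBar0 μ) (A : Set Ω) (hA : MeasurableSet A) :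
    Set (stratum μ E A hA × stratum μ (L0 μ) A hA) :=
  {z | ∀ᵐ ω ∂μ, ω ∈ A → f (z.1 : E) ω ≤ (((z.2 : L0 μ) ω : ℝ) : EReal)}

/-- `f_A` is `𝒯_c`-lower semicontinuous: its epigraph is closed in
`(E^A, 𝒯_c) × (L⁰(A ∩ ℱ), 𝒯_c)`. The topology `𝒯_c` of a stratum is the subspace topology, because
all elements of a stratum have random seminorms vanishing off `A`. -/
def LscOn (P : Set (E → L0 μ)) (f : E → LBar0 μ) (A : Set Ω) (hA : MeasurableSet A) : Prop :=
  IsClosed[@instTopologicalSpaceProd _ _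
    (TopologicalSpace.induced (Subtype.val : stratum μ E A hA → E) (tc P))
    (TopologicalSpace.induced (Subtype.val : stratum μ (L0 μ) A hA → L0 μ) (tcL0 μ))]
    (epiOn f A hA)

/-- `f` is a `𝒯_c`-closed (local) function. -/
structure IsTcClosed [IsFiniteMeasure μ] (P : Set (E → L0 μ)) (f : E → LBar0 μ) : Prop where
  isLocal : IsLocal f
  eq_bot : ∀ x : E, ∀ᵐ ω ∂μ, ω ∈ MI f → f x ω = ⊥
  regular : ∀ (A : Set Ω) (hA : MeasurableSet A), A ⊆ BP f → 0 < μ A → ProperOn f A hA →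
    ConvexOnEvent f A hA ∧ LscOn P f A hA

/-- `h` is the `𝒯_c`-closure `Cl_c(f)`: the greatest `𝒯_c`-closed function majorized by `f`. -/
def IsClosureC [IsFiniteMeasure μ] (P : Set (E → L0 μ)) (f h : E → LBar0 μ) : Prop :=
  IsGreatest {k : E → LBar0 μ | IsTcClosed P k ∧ k ≤ f} h

end Modules

end RandomConvex

end

open MeasureTheory Filter
open scoped Topology

noncomputable section

namespace RandomConvex

/-! ### Order, generalized inverse and Dedekind completeness of `L0 μ`. -/

section OrderedAlgebra

variable {Ω : Type*} [MeasurableSpace Ω] {μ : Measure Ω}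

/-! Biconjugation is monotone and lies below the identity (`biconjC_mono`, `biconjC_le`). It
therefore suffices that every biconjugate is closed and that every closed `k` satisfies `k ≤ biconjC
P k`: a closed `k ≤ f` then lies below `biconjC P k ≤ biconjC P f`.

The first point, `biconjC_isTcClosed`, is soft: a biconjugate is an essential supremum of continuous
affine functions, and locality, convexity and closedness of the epigraph all pass to such suprema.
If it is `⊥` at one point on an event, all conjugate values are `⊤` there, so it is `⊥` at every
point there.

The second point is the Fenchel–Moreau inequality `IsTcClosed.le_biconjC`. On `MI k` a closed
function is `⊥`, and on `PI k` the functional `0` already makes the biconjugate `⊤`. On `BP k`, a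
failure gives a rational strictly between the two functions at some `x` on a nonnull event, and it
is enough to find an affine minorant reaching that level at `x` on some nonnull subevent
(`IsTcClosed.exists_dual`).

Such a minorant is found as follows. Lower semicontinuity and countable concatenation bound `k` from
below on a ball, on a nonnull subevent (`exists_ball_lt`). This is used at `x` with the given level,
and at a point where `k` is finite; there convexity turns the local bound into a global one with
linear decay (`ae_le_of_convex_of_ball`). Together the two bounds put `k` above `r - q(· - x)` for a
continuous `L⁰`-seminorm `q`. A sandwich theorem, deduced from an `L⁰`-valued Hahn–Banach theorem,
inserts a linear map between the epigraph and this minorant; being dominated by `q`, it is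
continuous. -/

theorem ae_ind_of_mem (A : Set Ω) (hA : MeasurableSet A) :
    ∀ᵐ ω ∂μ, ω ∈ A → (ind A hA : L0 μ) ω = 1 := by
  filter_upwards [AEEqFun.coeFn_mk (μ := μ) (A.indicator fun _ => (1 : ℝ))
    ((measurable_const.indicator hA).aestronglyMeasurable)] with ω h hω
  exact h.trans (Set.indicator_of_mem hω _)

theorem ae_ind_of_notMem (A : Set Ω) (hA : MeasurableSet A) :
    ∀ᵐ ω ∂μ, ω ∉ A → (ind A hA : L0 μ) ω = 0 := by
  filter_upwards [AEEqFun.coeFn_mk (μ := μ) (A.indicator fun _ => (1 : ℝ))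
    ((measurable_const.indicator hA).aestronglyMeasurable)] with ω h hω
  exact h.trans (Set.indicator_of_notMem hω _)

theorem L0.measurable (ξ : L0 μ) : Measurable ξ := ξ.stronglyMeasurable.measurable

theorem LBar0.measurable (ξ : LBar0 μ) : Measurable ξ := ξ.stronglyMeasurable.measurable

theorem ae_nonneg {ξ : L0 μ} (h : 0 ≤ ξ) : ∀ᵐ ω ∂μ, 0 ≤ ξ ω := by
  filter_upwards [AEEqFun.coeFn_le.2 h, AEEqFun.coeFn_zero (μ := μ) (β := ℝ)] with ω h1 h2
  simpa [h2] using h1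

theorem nonneg_of_ae {ξ : L0 μ} (h : ∀ᵐ ω ∂μ, 0 ≤ ξ ω) : 0 ≤ ξ := by
  rw [← AEEqFun.coeFn_le]
  filter_upwards [h, AEEqFun.coeFn_zero (μ := μ) (β := ℝ)] with ω h1 h2
  simpa [h2] using h1

instance instIsOrderedAddMonoidL0 : IsOrderedAddMonoid (Ω →ₘ[μ] ℝ) where
  add_le_add_left a b h c := by
    rw [← AEEqFun.coeFn_le] at h ⊢
    filter_upwards [h, AEEqFun.coeFn_add a c, AEEqFun.coeFn_add b c] with ω h1 h2 h3
    simp only [h2, h3, Pi.add_apply]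
    linarith

instance instIsOrderedRingL0 : IsOrderedRing (Ω →ₘ[μ] ℝ) :=
  haveI : ZeroLEOneClass (Ω →ₘ[μ] ℝ) := ⟨nonneg_of_ae (by
    filter_upwards [AEEqFun.coeFn_one (μ := μ) (β := ℝ)] with ω h
    simp [h])⟩
  IsOrderedRing.of_mul_nonneg fun a b ha hb => nonneg_of_ae (by
    filter_upwards [ae_nonneg ha, ae_nonneg hb, AEEqFun.coeFn_mul a b] with ω h1 h2 h3
    rw [h3]
    exact mul_nonneg h1 h2)

/-- The generalized inverse in `L⁰(ℱ)`, equal to `1 / ξ` on `{ξ ≠ 0}` and to `0` on `{ξ = 0}`. -/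
def pinv (ξ : L0 μ) : L0 μ := AEEqFun.compMeasurable (fun a : ℝ => a⁻¹) measurable_inv ξ

theorem ae_pinv (ξ : L0 μ) : ∀ᵐ ω ∂μ, pinv ξ ω = (ξ ω)⁻¹ :=
  AEEqFun.coeFn_compMeasurable _ _ _

theorem pinv_nonneg {ξ : L0 μ} (h : 0 ≤ ξ) : 0 ≤ pinv ξ := nonneg_of_ae (by
  filter_upwards [ae_nonneg h, ae_pinv ξ] with ω h1 h2
  rw [h2]
  exact inv_nonneg.2 h1)

theorem mul_pinv_mul (ξ : L0 μ) : ξ * (pinv ξ * ξ) = ξ := by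
  apply AEEqFun.ext
  filter_upwards [AEEqFun.coeFn_mul ξ (pinv ξ * ξ), AEEqFun.coeFn_mul (pinv ξ) ξ, ae_pinv ξ]
    with ω h1 h2 h3
  rw [h1, Pi.mul_apply, h2, Pi.mul_apply, h3]
  by_cases h : ξ ω = 0
  · simp [h]
  · field_simp

theorem pinv_mul_le_one (ξ : L0 μ) : pinv ξ * ξ ≤ 1 := by
  rw [← AEEqFun.coeFn_le]
  filter_upwards [AEEqFun.coeFn_mul (pinv ξ) ξ, ae_pinv ξ, AEEqFun.coeFn_one (μ := μ) (β := ℝ)]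
    with ω h2 h3 h4
  rw [h2, Pi.mul_apply, h3, h4, Pi.one_apply]
  by_cases h : ξ ω = 0
  · simp [h]
  · rw [inv_mul_cancel₀ h]

/-- `L⁰(ℱ)` is Dedekind complete. -/
theorem L0.exists_isGLB [IsFiniteMeasure μ] {S : Set (L0 μ)} (hne : S.Nonempty)
    (hb : BddBelow S) : ∃ s, IsGLB S s := by
  -- The infimum is minus the supremum of the negatives in `LBar0 μ`. A lower bound and a member of
  -- `S` force that supremum to be finite a.s.
  let emb : L0 μ → LBar0 μ := fun ξ => AEEqFun.comp (fun a : ℝ => ((-a : ℝ) : EReal))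
    (continuous_coe_real_ereal.comp continuous_neg) ξ
  have hemb : ∀ ξ, ∀ᵐ ω ∂μ, emb ξ ω = ((-ξ ω : ℝ) : EReal) := fun ξ => AEEqFun.coeFn_comp _ _ _
  obtain ⟨s, hs⟩ := exists_isLUB (emb '' S)
  obtain ⟨ξ₀, hξ₀⟩ := hne
  obtain ⟨b, hb⟩ := hb
  have key : ∀ b ∈ lowerBounds S, ∀ᵐ ω ∂μ, s ω ≤ ((-b ω : ℝ) : EReal) := by
    intro b hb
    have h : s ≤ emb b := hs.2 (by
      rintro _ ⟨ξ, hξ, rfl⟩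
      rw [← AEEqFun.coeFn_le]
      filter_upwards [hemb ξ, hemb b, AEEqFun.coeFn_le.2 (hb hξ)] with ω h1 h2 h3
      rw [h1, h2]
      exact EReal.coe_le_coe_iff.2 (neg_le_neg h3))
    filter_upwards [AEEqFun.coeFn_le.2 h, hemb b] with ω h1 h2
    rwa [← h2]
  have key' : ∀ ξ ∈ S, ∀ᵐ ω ∂μ, ((-ξ ω : ℝ) : EReal) ≤ s ω := by
    intro ξ hξ
    filter_upwards [AEEqFun.coeFn_le.2 (hs.1 ⟨ξ, hξ, rfl⟩), hemb ξ] with ω h1 h2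
    rwa [← h2]
  have hm : Measurable fun ω => -(s ω).toReal := (measurable_ereal_toReal.comp s.measurable).neg
  have hfin : ∀ᵐ ω ∂μ, s ω = (((s ω).toReal : ℝ) : EReal) := by
    filter_upwards [key b hb, key' ξ₀ hξ₀] with ω h1 h2
    rw [EReal.coe_toReal]
    · exact (h1.trans_lt (EReal.coe_lt_top _)).ne
    · exact ((EReal.bot_lt_coe _).trans_le h2).ne'
  refine ⟨AEEqFun.mk _ hm.aestronglyMeasurable, fun ξ hξ => ?_, fun b hb => ?_⟩
  · rw [← AEEqFun.coeFn_le]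
    filter_upwards [hfin, key' ξ hξ, AEEqFun.coeFn_mk _ hm.aestronglyMeasurable (μ := μ)]
      with ω h1 h2 h3
    rw [h1, EReal.coe_le_coe_iff] at h2
    rw [h3]
    linarith
  · rw [← AEEqFun.coeFn_le]
    filter_upwards [hfin, key b hb, AEEqFun.coeFn_mk _ hm.aestronglyMeasurable (μ := μ)]
      with ω h1 h2 h3
    rw [h1, EReal.coe_le_coe_iff] at h2
    rw [h3]
    linarith

/-- A nonnegative factor can be moved through an infimum in `L⁰(ℱ)`. -/
theorem L0.le_mul_of_isGLB {S : Set (L0 μ)} {s ξ c : L0 μ} (hs : IsGLB S s) (hne : S.Nonempty)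
    (hξ : 0 ≤ ξ) (hc : ∀ t ∈ S, c ≤ ξ * t) : c ≤ ξ * s := by
  -- This candidate is again a lower bound of `S`, hence at most `s`. Where `ξ` vanishes, the claim
  -- reads `c ≤ 0` and follows from any single member of `S`.
  have hm : Measurable fun ω => if 0 < ξ ω then c ω / ξ ω else s ω :=
    Measurable.ite (measurableSet_lt measurable_const ξ.measurable)
      (c.measurable.div ξ.measurable) s.measurable
  have hb : AEEqFun.mk _ hm.aestronglyMeasurable ≤ s := hs.2 (by
    intro t ht
    rw [← AEEqFun.coeFn_le]
    filter_upwards [AEEqFun.coeFn_mk _ hm.aestronglyMeasurable (μ := μ),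
      AEEqFun.coeFn_le.2 (hs.1 ht), AEEqFun.coeFn_le.2 (hc t ht), AEEqFun.coeFn_mul ξ t]
      with ω h1 h2 h3 h4
    rw [h1]
    split_ifs with h
    · rw [h4, Pi.mul_apply] at h3
      rw [div_le_iff₀ h]
      linarith
    · exact h2)
  obtain ⟨t, ht⟩ := hne
  rw [← AEEqFun.coeFn_le]
  filter_upwards [AEEqFun.coeFn_mk _ hm.aestronglyMeasurable (μ := μ), AEEqFun.coeFn_le.2 hb,
    AEEqFun.coeFn_le.2 (hc t ht), AEEqFun.coeFn_mul ξ t, AEEqFun.coeFn_mul ξ s, ae_nonneg hξ]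
    with ω h1 h2 h3 h4 h5 h6
  rw [h5, Pi.mul_apply]
  rw [h4, Pi.mul_apply] at h3
  rw [h1] at h2
  split_ifs at h2 with h
  · rw [div_le_iff₀ h] at h2
    linarith
  · have h0 : ξ ω = 0 := le_antisymm (not_lt.1 h) h6
    simpa [h0] using h3

end OrderedAlgebra

/-! ### Hahn–Banach and sandwich theorems for `L⁰`-sublinear maps. -/

section HahnBanach

variable {Ω : Type*} [MeasurableSpace Ω] {μ : Measure Ω}
variable {E : Type*} [AddCommGroup E] [Module (Ω →ₘ[μ] ℝ) E]

/-- `L⁰`-sublinear maps; homogeneity is a consequence, see `IsSublinear.smul_eq`. -/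
structure IsSublinear (T : E → L0 μ) : Prop where
  add_le : ∀ x y, T (x + y) ≤ T x + T y
  smul_le : ∀ (ξ : L0 μ) (x : E), 0 ≤ ξ → T (ξ • x) ≤ ξ * T x

namespace IsSublinear

variable {T : E → L0 μ}

theorem map_zero (hT : IsSublinear T) : T 0 = 0 := by
  apply le_antisymm
  · simpa using hT.smul_le 0 0 le_rfl
  · simpa using hT.add_le 0 0

theorem neg_le (hT : IsSublinear T) (x : E) : -T (-x) ≤ T x := by
  have h := hT.add_le x (-x)
  rw [add_neg_cancel, hT.map_zero] at h
  exact neg_le_iff_add_nonneg.2 h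

/-- Subadditivity for `x = e • x + (1 - e) • x`, the second term being bounded by `(1 - e) * T x`.
-/
theorem mul_le_smul (hT : IsSublinear T) {e : L0 μ} (he1 : e ≤ 1) (x : E) :
    e * T x ≤ T (e • x) := by
  have h := hT.add_le (e • x) ((1 - e) • x)
  rw [← add_smul, add_sub_cancel, one_smul] at h
  have h2 := h.trans (add_le_add_right (hT.smul_le (1 - e) x (sub_nonneg.2 he1)) _)
  have h3 := sub_le_iff_le_add.2 h2
  rwa [sub_mul, one_mul, sub_sub_cancel] at h3

/-- A scalar `ξ` is invertible only on `{ξ ≠ 0}`. The product `pinv ξ * ξ` is the indicator of that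
event and is absorbed by `ξ`, so the usual division argument works after localizing with
`mul_le_smul`. -/
theorem smul_eq (hT : IsSublinear T) {ξ : L0 μ} (hξ : 0 ≤ ξ) (x : E) : T (ξ • x) = ξ * T x := by
  refine le_antisymm (hT.smul_le ξ x hξ) ?_
  have he : pinv ξ * ξ ≤ 1 := pinv_mul_le_one ξ
  calc ξ * T x = ξ * (pinv ξ * ξ * T x) := by rw [← mul_assoc, mul_pinv_mul]
    _ ≤ ξ * T ((pinv ξ * ξ) • x) := mul_le_mul_of_nonneg_left (hT.mul_le_smul he x) hξ
    _ = ξ * T (pinv ξ • ξ • x) := by rw [mul_smul]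
    _ ≤ ξ * (pinv ξ * T (ξ • x)) :=
        mul_le_mul_of_nonneg_left (hT.smul_le _ _ (pinv_nonneg hξ)) hξ
    _ = (pinv ξ * ξ) * T (ξ • x) := by ring
    _ ≤ T ((pinv ξ * ξ) • ξ • x) := hT.mul_le_smul he _
    _ = T (ξ • x) := by rw [← mul_smul, mul_comm (pinv ξ * ξ) ξ, mul_pinv_mul]

/-- An infimum of expressions that is compatible with addition and nonnegative scalars is
sublinear. -/
theorem of_isGLB {F : E → Set (L0 μ)} (hT : ∀ x, IsGLB (F x) (T x)) (hne : ∀ x, (F x).Nonempty)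
    (hadd : ∀ x y, ∀ s ∈ F x, ∀ t ∈ F y, ∃ u ∈ F (x + y), u ≤ s + t)
    (hsmul : ∀ (ξ : L0 μ) x, 0 ≤ ξ → ∀ s ∈ F x, ∃ u ∈ F (ξ • x), u ≤ ξ * s) :
    IsSublinear T where
  add_le x y := by
    rw [← sub_le_iff_le_add]
    refine (hT x).2 fun s hs => ?_
    rw [sub_le_comm]
    refine (hT y).2 fun t ht => ?_
    obtain ⟨u, hu, hust⟩ := hadd x y s hs t ht
    exact sub_le_iff_le_add'.2 (((hT _).1 hu).trans hust)
  smul_le ξ x hξ := L0.le_mul_of_isGLB (hT x) (hne x) hξ fun s hs => by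
    obtain ⟨u, hu, hus⟩ := hsmul ξ x hξ s hs
    exact ((hT _).1 hu).trans hus

variable [IsFiniteMeasure μ]

/-- Zorn's lemma for the reversed order. The pointwise infimum of a chain exists because `-S (-x)`
bounds every member below at `x`; it is subadditive because of two members of a chain the smaller
can serve for both summands. -/
theorem exists_minimal_le {S : E → L0 μ} (hS : IsSublinear S) :
    ∃ T, T ≤ S ∧ Minimal (fun T : E → L0 μ => IsSublinear T ∧ T ≤ S) T := by
  let K : Set (E → L0 μ) := {T | IsSublinear T ∧ T ≤ S}
  suffices h : ∀ c ⊆ K, IsChain (· ≤ ·) c → ∀ T₀ ∈ c, ∃ R ∈ K, ∀ T ∈ c, R ≤ T from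
    @zorn_le_nonempty₀ (E → L0 μ)ᵒᵈ _ K (fun c hcs hc => h c hcs hc.symm) S ⟨hS, le_rfl⟩
  intro c hcs hc T₀ hT₀
  have hb : ∀ x, ∃ s, IsGLB {t | ∃ T : E → L0 μ, T ∈ c ∧ T x = t} s := fun x => by
    refine L0.exists_isGLB ⟨_, T₀, hT₀, rfl⟩ ⟨-S (-x), ?_⟩
    rintro _ ⟨T, hT, rfl⟩
    exact (neg_le_neg ((hcs hT).2 (-x))).trans ((hcs hT).1.neg_le x)
  choose R hR using hb
  refine ⟨R, ⟨of_isGLB hR (fun x => ⟨_, T₀, hT₀, rfl⟩) ?_ ?_, fun x => ?_⟩, fun T hT x => ?_⟩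
  · rintro x y _ ⟨T, hT, rfl⟩ _ ⟨T', hT', rfl⟩
    rcases hc.total hT hT' with h | h
    · exact ⟨_, ⟨T, hT, rfl⟩, ((hcs hT).1.add_le x y).trans (add_le_add_right (h y) _)⟩
    · exact ⟨_, ⟨T', hT', rfl⟩, ((hcs hT').1.add_le x y).trans (add_le_add_left (h x) _)⟩
  · rintro ξ x hξ _ ⟨T, hT, rfl⟩
    exact ⟨_, ⟨T, hT, rfl⟩, (hcs hT).1.smul_le ξ x hξ⟩
  · exact ((hR x).1 ⟨T₀, hT₀, rfl⟩).trans ((hcs hT₀).2 x)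
  · exact (hR x).1 ⟨T, hT, rfl⟩

/-- The Hahn–Banach theorem for `L⁰`-sublinear maps. -/
theorem exists_linear_le {S : E → L0 μ} (hS : IsSublinear S) :
    ∃ g : E →ₗ[Ω →ₘ[μ] ℝ] (Ω →ₘ[μ] ℝ), ∀ x, g x ≤ S x := by
  obtain ⟨T, hTS, ⟨hT, -⟩, hmin⟩ := hS.exists_minimal_le
  have hsuper : ∀ x z, T z + T x ≤ T (z + x) := by
    intro x
    -- The infimum over `l` is a sublinear map below `T`, so by minimality it equals `T`. Taking `l
    -- = 1` then gives superadditivity.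
    have hb : ∀ z, ∃ s, IsGLB {t | ∃ l : L0 μ, 0 ≤ l ∧ T (z + l • x) - l * T x = t} s := by
      intro z
      refine L0.exists_isGLB ⟨_, 0, le_rfl, rfl⟩ ⟨-T (-z), ?_⟩
      rintro _ ⟨l, hl, rfl⟩
      have h := hT.add_le (z + l • x) (-z)
      rw [add_neg_cancel_comm, hT.smul_eq hl] at h
      rw [le_sub_iff_add_le, neg_add_le_iff_le_add, add_comm]
      exact h
    choose R hR using hb
    have hRsub : IsSublinear R := by
      refine of_isGLB hR (fun z => ⟨_, 0, le_rfl, rfl⟩) ?_ ?_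
      · rintro y z _ ⟨l, hl, rfl⟩ _ ⟨m, hm, rfl⟩
        refine ⟨_, ⟨l + m, add_nonneg hl hm, rfl⟩, ?_⟩
        have h := hT.add_le (y + l • x) (z + m • x)
        rw [add_add_add_comm, ← add_smul] at h
        calc _ ≤ T (y + l • x) + T (z + m • x) - (l + m) * T x := sub_le_sub_right h _
          _ = _ := by ring
      · rintro ξ z hξ _ ⟨l, hl, rfl⟩
        refine ⟨_, ⟨ξ * l, mul_nonneg hξ hl, rfl⟩, ?_⟩
        have h := hT.smul_le ξ (z + l • x) hξ
        rw [smul_add, ← mul_smul] at h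
        calc _ ≤ ξ * T (z + l • x) - ξ * l * T x := sub_le_sub_right h _
          _ = _ := by ring
    have hRT : R ≤ T := fun z => (hR z).1 ⟨0, le_rfl, by simp⟩
    have hTR : T ≤ R := hmin ⟨hRsub, hRT.trans hTS⟩ hRT
    intro z
    have h := (hTR z).trans ((hR z).1 ⟨1, zero_le_one, rfl⟩)
    rw [one_smul, one_mul] at h
    exact le_sub_iff_add_le.1 h
  have hadd : ∀ x y, T (x + y) = T x + T y := fun x y =>
    le_antisymm (hT.add_le x y) (hsuper y x)
  have hneg : ∀ x, T (-x) = -T x := fun x => by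
    have h := hadd x (-x)
    rw [add_neg_cancel, hT.map_zero] at h
    exact (neg_eq_of_add_eq_zero_right h.symm).symm
  have hsmul : ∀ (ξ : L0 μ) x, T (ξ • x) = ξ * T x := by
    intro ξ x
    -- A difference of nonnegative scalars, for which homogeneity is known.
    have hd : ξ = ξ ⊔ 0 - (ξ ⊔ 0 - ξ) := by ring
    have h1 : (0 : L0 μ) ≤ ξ ⊔ 0 := le_sup_right
    have h2 : 0 ≤ ξ ⊔ 0 - ξ := sub_nonneg.2 le_sup_left
    rw [hd, sub_smul, sub_eq_add_neg, hadd, hneg, hT.smul_eq h1, hT.smul_eq h2]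
    ring
  exact ⟨{ toFun := T, map_add' := hadd, map_smul' := hsmul }, hTS⟩

end IsSublinear

theorem IsL0Seminorm.isSublinear {q : E → L0 μ} (hq : IsL0Seminorm q) : IsSublinear q where
  add_le := hq.add_le
  smul_le ξ x hξ := by rw [hq.smul, abs_of_nonneg hξ]

theorem IsL0Seminorm.map_neg {q : E → L0 μ} (hq : IsL0Seminorm q) (x : E) : q (-x) = q x := by
  have h := hq.smul (-1) x
  rwa [neg_smul, one_smul, abs_neg, abs_of_nonneg zero_le_one, one_mul] at h

/-- The sandwich theorem: an `L⁰`-convex subset of `E × L⁰` lying above the hypograph of `-q` is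
separated from it by the graph of a linear map. -/
theorem exists_linear_le_of_convex [IsFiniteMeasure μ] {q : E → L0 μ} (hq : IsL0Seminorm q)
    {C : Set (E × L0 μ)} (hne : C.Nonempty)
    (hC : ∀ u ∈ C, ∀ v ∈ C, ∀ ξ : L0 μ, 0 ≤ ξ → ξ ≤ 1 → ξ • u + (1 - ξ) • v ∈ C)
    (hqC : ∀ u ∈ C, 0 ≤ u.2 + q u.1) :
    ∃ g : E →ₗ[Ω →ₘ[μ] ℝ] (Ω →ₘ[μ] ℝ), (∀ x, g x ≤ q x) ∧ ∀ u ∈ C, g u.1 ≤ u.2 := by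
  obtain ⟨u₀, hu₀⟩ := hne
  -- The infimum of `F z` is the largest sublinear candidate compatible with both constraints: `l =
  -- 0` gives domination by `q`, while `l = 1` and `z = u.1` give the bound by `u.2`.
  let F : E → Set (L0 μ) := fun z =>
    {t | ∃ l : L0 μ, 0 ≤ l ∧ ∃ u ∈ C, l * u.2 + q (z - l • u.1) = t}
  have hFne : ∀ z, (F z).Nonempty := fun z => ⟨_, 0, le_rfl, u₀, hu₀, rfl⟩
  have hb : ∀ z, ∃ s, IsGLB (F z) s := by
    intro z
    refine L0.exists_isGLB (hFne z) ⟨-q z, ?_⟩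
    rintro _ ⟨l, hl, u, hu, rfl⟩
    have h1 : 0 ≤ l * u.2 + q (l • u.1) := by
      rw [hq.smul, abs_of_nonneg hl, ← mul_add]
      exact mul_nonneg hl (hqC u hu)
    have h2 : q (l • u.1) ≤ q z + q (z - l • u.1) := by
      have h := hq.add_le z (-(z - l • u.1))
      rwa [hq.map_neg, neg_sub, add_sub_cancel] at h
    rw [neg_le_iff_add_nonneg]
    calc 0 ≤ l * u.2 + q (l • u.1) := h1
      _ ≤ l * u.2 + (q z + q (z - l • u.1)) := add_le_add_right h2 _
      _ = _ := by ring
  choose R hR using hb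
  have hRsub : IsSublinear R := by
    refine IsSublinear.of_isGLB hR hFne ?_ ?_
    · rintro x y _ ⟨l, hl, u, hu, rfl⟩ _ ⟨m, hm, v, hv, rfl⟩
      -- The convex weight `l / (l + m)`. Where `l + m = 0`, both `l` and `m` vanish, so `e1` and
      -- `e2` hold there too.
      set ξ := pinv (l + m) * l with hξ
      have hlm : 0 ≤ l + m := add_nonneg hl hm
      have hξ0 : 0 ≤ ξ := mul_nonneg (pinv_nonneg hlm) hl
      have hξ1 : ξ ≤ 1 := le_trans
        (mul_le_mul_of_nonneg_left (le_add_of_nonneg_right hm) (pinv_nonneg hlm))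
        (pinv_mul_le_one _)
      have e1 : (l + m) * ξ = l := by
        apply AEEqFun.ext
        filter_upwards [AEEqFun.coeFn_mul (l + m) ξ, AEEqFun.coeFn_mul (pinv (l + m)) l,
          ae_pinv (l + m), AEEqFun.coeFn_add l m, ae_nonneg hl, ae_nonneg hm]
          with ω h1 h2 h3 h4 h5 h6
        rw [h1, Pi.mul_apply, hξ, h2, Pi.mul_apply, h3, h4, Pi.add_apply]
        by_cases h : l ω + m ω = 0
        · rw [h]
          simp only [inv_zero, zero_mul]
          linarith
        · field_simp
      have e2 : (l + m) * (1 - ξ) = m := by rw [mul_sub, e1]; ring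
      refine ⟨_, ⟨l + m, hlm, _, hC u hu v hv ξ hξ0 hξ1, rfl⟩, ?_⟩
      have h := hq.add_le (x - l • u.1) (y - m • v.1)
      have e3 : (l + m) * (ξ • u + (1 - ξ) • v).2 = l * u.2 + m * v.2 := by
        simp only [Prod.snd_add, Prod.smul_snd, smul_eq_mul, mul_add, ← mul_assoc, e1, e2]
      have e4 : x + y - (l + m) • (ξ • u + (1 - ξ) • v).1
          = x - l • u.1 + (y - m • v.1) := by
        simp only [Prod.fst_add, Prod.smul_fst, smul_add, ← mul_smul, e1, e2]
        abel
      rw [e3, e4]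
      calc _ ≤ l * u.2 + m * v.2 + (q (x - l • u.1) + q (y - m • v.1)) := add_le_add_right h _
        _ = _ := by ring
    · rintro ξ z hξ _ ⟨l, hl, u, hu, rfl⟩
      refine ⟨_, ⟨ξ * l, mul_nonneg hξ hl, u, hu, rfl⟩, le_of_eq ?_⟩
      rw [mul_smul, ← smul_sub, hq.smul, abs_of_nonneg hξ]
      ring
  obtain ⟨g, hg⟩ := hRsub.exists_linear_le
  refine ⟨g, fun x => (hg x).trans ((hR x).1 ⟨0, le_rfl, u₀, hu₀, by simp⟩), fun u hu =>
    (hg _).trans ((hR _).1 ⟨1, zero_le_one, u, hu, ?_⟩)⟩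
  simp [hq.isSublinear.map_zero]

end HahnBanach

/-! ### Gluing along events, and countable concatenation. -/

section Locality

variable {Ω : Type*} [MeasurableSpace Ω] {μ : Measure Ω}
variable {E : Type*} [AddCommGroup E] [Module (Ω →ₘ[μ] ℝ) E]

theorem ind_mul_self (A : Set Ω) (hA : MeasurableSet A) :
    (ind A hA : L0 μ) * ind A hA = ind A hA := by
  apply AEEqFun.ext
  filter_upwards [AEEqFun.coeFn_mul (ind A hA : L0 μ) (ind A hA), ae_ind_of_mem (μ := μ) A hA,
    ae_ind_of_notMem (μ := μ) A hA] with ω h1 h2 h3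
  rw [h1, Pi.mul_apply]
  by_cases h : ω ∈ A
  · rw [h2 h, mul_one]
  · rw [h3 h, mul_zero]

theorem ind_smul_ind_smul (A : Set Ω) (hA : MeasurableSet A) (x : E) :
    (ind A hA : L0 μ) • (ind A hA : L0 μ) • x = (ind A hA : L0 μ) • x := by
  rw [← mul_smul, ind_mul_self]

theorem ind_compl (A : Set Ω) (hA : MeasurableSet A) :
    (ind Aᶜ hA.compl : L0 μ) = 1 - ind A hA := by
  apply AEEqFun.ext
  filter_upwards [AEEqFun.coeFn_sub 1 (ind A hA : L0 μ), AEEqFun.coeFn_one (μ := μ) (β := ℝ),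
    ae_ind_of_mem (μ := μ) A hA, ae_ind_of_notMem (μ := μ) A hA,
    ae_ind_of_mem (μ := μ) Aᶜ hA.compl, ae_ind_of_notMem (μ := μ) Aᶜ hA.compl]
    with ω h1 h2 h3 h4 h5 h6
  rw [h1, Pi.sub_apply, h2, Pi.one_apply]
  by_cases h : ω ∈ A
  · rw [h3 h, h6 (by simpa using h), sub_self]
  · rw [h4 h, h5 h, sub_zero]

/-- Two elements can be glued along an event and its complement. -/
theorem exists_glue (A : Set Ω) (hA : MeasurableSet A) (x y : E) :
    ∃ z : E, (ind A hA : L0 μ) • z = (ind A hA : L0 μ) • x ∧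
      (ind Aᶜ hA.compl : L0 μ) • z = (ind Aᶜ hA.compl : L0 μ) • y := by
  have h0 : (ind A hA : L0 μ) * (1 - ind A hA) = 0 := by
    rw [mul_sub, ind_mul_self, mul_one, sub_self]
  refine ⟨(ind A hA : L0 μ) • x + (ind Aᶜ hA.compl : L0 μ) • y, ?_, ?_⟩
  · rw [smul_add, ind_smul_ind_smul, ind_compl A hA, ← mul_smul, h0, zero_smul, add_zero]
  · rw [smul_add, ind_smul_ind_smul, ind_compl A hA, ← mul_smul, mul_comm, h0, zero_smul, zero_add]

theorem IsLocal.ae_eq {f : E → LBar0 μ} (hf : IsLocal f) {A : Set Ω} {hA : MeasurableSet A}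
    {x y : E} (h : (ind A hA : L0 μ) • x = (ind A hA : L0 μ) • y) :
    ∀ᵐ ω ∂μ, ω ∈ A → f x ω = f y ω := by
  filter_upwards [hf x A hA, hf y A hA] with ω h1 h2 hω
  rw [h1 hω, h2 hω, h]

theorem ae_linear_ind_smul (g : E →ₗ[Ω →ₘ[μ] ℝ] (Ω →ₘ[μ] ℝ)) (A : Set Ω) (hA : MeasurableSet A)
    (x : E) : ∀ᵐ ω ∂μ, ω ∈ A → g ((ind A hA : L0 μ) • x) ω = g x ω := by
  rw [map_smul, smul_eq_mul]
  filter_upwards [AEEqFun.coeFn_mul (ind A hA : L0 μ) (g x), ae_ind_of_mem (μ := μ) A hA]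
    with ω h1 h2 hω
  rw [h1, Pi.mul_apply, h2 hω, one_mul]

theorem ae_linear_eq (g : E →ₗ[Ω →ₘ[μ] ℝ] (Ω →ₘ[μ] ℝ)) {A : Set Ω} {hA : MeasurableSet A}
    {x y : E} (h : (ind A hA : L0 μ) • x = (ind A hA : L0 μ) • y) :
    ∀ᵐ ω ∂μ, ω ∈ A → g x ω = g y ω := by
  filter_upwards [ae_linear_ind_smul g A hA x, ae_linear_ind_smul g A hA y] with ω h1 h2 hω
  rw [← h1 hω, ← h2 hω, h]

theorem ae_abs_ind (A : Set Ω) (hA : MeasurableSet A) :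
    ∀ᵐ ω ∂μ, |(ind A hA : L0 μ)| ω = (ind A hA : L0 μ) ω := by
  filter_upwards [AEEqFun.coeFn_abs (ind A hA : L0 μ), ae_ind_of_mem (μ := μ) A hA,
    ae_ind_of_notMem (μ := μ) A hA] with ω h1 h2 h3
  rw [h1]
  by_cases h : ω ∈ A
  · rw [h2 h, abs_one]
  · rw [h3 h, abs_zero]

theorem IsL0Seminorm.ae_ind_smul {p : E → L0 μ} (hp : IsL0Seminorm p) (A : Set Ω)
    (hA : MeasurableSet A) (x : E) :
    ∀ᵐ ω ∂μ, p ((ind A hA : L0 μ) • x) ω = A.indicator (p x) ω := by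
  rw [hp.smul]
  filter_upwards [AEEqFun.coeFn_mul |(ind A hA : L0 μ)| (p x), ae_ind_of_mem (μ := μ) A hA,
    ae_ind_of_notMem (μ := μ) A hA, ae_abs_ind (μ := μ) A hA] with ω h1 h2 h3 h4
  rw [h1, Pi.mul_apply, h4]
  by_cases h : ω ∈ A
  · rw [h2 h, one_mul, Set.indicator_of_mem h]
  · rw [h3 h, zero_mul, Set.indicator_of_notMem h]

theorem IsL0Seminorm.ae_sub_eq {p : E → L0 μ} (hp : IsL0Seminorm p) {A : Set Ω}
    {hA : MeasurableSet A} {x y : E} (h : (ind A hA : L0 μ) • x = (ind A hA : L0 μ) • y) (z : E) :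
    ∀ᵐ ω ∂μ, ω ∈ A → p (x - z) ω = p (y - z) ω := by
  filter_upwards [hp.ae_ind_smul A hA (x - z), hp.ae_ind_smul A hA (y - z)] with ω h1 h2 hω
  rw [Set.indicator_of_mem hω] at h1 h2
  rw [← h1, ← h2, smul_sub, smul_sub, h]

/-- A local property is satisfied by some element on the largest possible event. -/
theorem exists_forall_ae_imp [IsFiniteMeasure μ] (hE : HasCCP (μ := μ) (Set.univ : Set E))
    (Φ : E → Ω → Prop) (hm : ∀ y, MeasurableSet {ω | Φ y ω})
    (hΦ : ∀ (A : Set Ω) (hA : MeasurableSet A) (x y : E),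
      (ind A hA : L0 μ) • x = (ind A hA : L0 μ) • y → ∀ᵐ ω ∂μ, ω ∈ A → Φ x ω → Φ y ω) :
    ∃ z, ∀ y, ∀ᵐ ω ∂μ, Φ y ω → Φ z ω := by
  obtain ⟨C, -, hCc, hC⟩ :=
    exists_countable_cover (μ := μ) (Set.univ : Set E) (fun y => {ω | Φ y ω}) hm
  rcases C.eq_empty_or_nonempty with rfl | hne
  · refine ⟨0, fun y => ?_⟩
    filter_upwards [hC y trivial] with ω h hω
    simpa using h hω
  obtain ⟨u, rfl⟩ := hCc.exists_eq_range hne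
  -- Countably many `u n` already exhaust the event where the property can hold; `z` follows the
  -- first `u n` that satisfies it.
  set D : ℕ → Set Ω := disjointed fun n => {ω | Φ (u n) ω} with hD
  have hDm : ∀ n, MeasurableSet (D n) := MeasurableSet.disjointed fun n => hm (u n)
  have hDu : ⋃ n, D n = ⋃ n, {ω | Φ (u n) ω} := iUnion_disjointed
  -- Cell `0` is the leftover event, where `z` is set to `0`; the others are shifted by one.
  let A : ℕ → Set Ω := fun n => Nat.casesOn n (⋃ n, D n)ᶜ D
  have hA : IsPartition A := by
    refine ⟨fun n => ?_, fun m n hmn => ?_, ?_⟩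
    · cases n with
      | zero => exact (MeasurableSet.iUnion hDm).compl
      | succ n => exact hDm n
    · cases m with
      | zero =>
        cases n with
        | zero => exact absurd rfl hmn
        | succ n => exact Set.disjoint_compl_left_iff_subset.2 (Set.subset_iUnion D n)
      | succ m =>
        cases n with
        | zero => exact Set.disjoint_compl_right_iff_subset.2 (Set.subset_iUnion D m)
        | succ n => exact disjoint_disjointed _ fun h => hmn (congrArg _ h)
    · refine Set.eq_univ_of_forall fun ω => ?_
      by_cases h : ω ∈ ⋃ n, D n
      · obtain ⟨n, hn⟩ := Set.mem_iUnion.1 h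
        exact Set.mem_iUnion.2 ⟨n + 1, hn⟩
      · exact Set.mem_iUnion.2 ⟨0, h⟩
  obtain ⟨z, -, hz⟩ := hE A hA (fun n => Nat.casesOn n 0 u) fun _ => trivial
  refine ⟨z, fun y => ?_⟩
  have hall : ∀ᵐ ω ∂μ, ∀ n, ω ∈ D n → Φ (u n) ω → Φ z ω :=
    ae_all_iff.2 fun n => hΦ (A (n + 1)) (hA.measurable (n + 1)) (u n) z (hz (n + 1)).symm
  filter_upwards [hC y trivial, hall] with ω h1 h2 hω
  have h3 := h1 hω
  rw [Set.biUnion_range, ← hDu] at h3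
  obtain ⟨n, hn⟩ := Set.mem_iUnion.1 h3
  exact h2 n hn (disjointed_subset _ n hn)

end Locality

/-! ### The topology `𝒯_c`, its continuous seminorms, and lower semicontinuity. -/

section Topology

variable {Ω : Type*} [MeasurableSpace Ω] {μ : Measure Ω}
variable {E : Type*} [AddCommGroup E] [Module (Ω →ₘ[μ] ℝ) E]

theorem IsPosOn.nonneg {ε : L0 μ} (hε : IsPosOn ε) : 0 ≤ ε :=
  nonneg_of_ae (hε.mono fun _ h => h.le)

theorem IsPosOn.inf {ε δ : L0 μ} (hε : IsPosOn ε) (hδ : IsPosOn δ) : IsPosOn (ε ⊓ δ) := by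
  filter_upwards [AEEqFun.coeFn_inf ε δ, hε, hδ] with ω h1 h2 h3
  rw [h1]
  exact lt_min h2 h3

theorem IsPosOn.exists_half {ε : L0 μ} (hε : IsPosOn ε) : ∃ δ : L0 μ, IsPosOn δ ∧ δ + δ = ε := by
  have h : ∀ᵐ ω ∂μ, AEEqFun.comp (fun a : ℝ => a / 2) (by fun_prop) ε ω = ε ω / 2 :=
    AEEqFun.coeFn_comp _ _ _
  refine ⟨AEEqFun.comp (fun a : ℝ => a / 2) (by fun_prop) ε, ?_, ?_⟩
  · filter_upwards [h, hε] with ω h1 h2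
    rw [h1]
    exact half_pos h2
  · apply AEEqFun.ext
    filter_upwards [h, AEEqFun.coeFn_add (AEEqFun.comp (fun a : ℝ => a / 2) (by fun_prop) ε)
      (AEEqFun.comp (fun a : ℝ => a / 2) (by fun_prop) ε)] with ω h1 h2
    rw [h2, Pi.add_apply, h1, add_halves]

/-- The points that are centres of some `Q`-ball contained in the given ball form an open set, by
halving the radius and the triangle inequality. -/
theorem tc_ball_mem_nhds {P Q : Set (E → L0 μ)} (hP : ∀ p ∈ P, IsL0Seminorm p) (hQ : Q ⊆ P)
    (hQf : Q.Finite) {ε : L0 μ} (hε : IsPosOn ε) (x : E) :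
    {y : E | ∀ p ∈ Q, p (y - x) ≤ ε} ∈ @nhds E (tc P) x := by
  let := tc P
  rw [mem_nhds_iff]
  refine ⟨{z | ∃ δ : L0 μ, IsPosOn δ ∧
    {y : E | ∀ p ∈ Q, p (y - z) ≤ δ} ⊆ {y : E | ∀ p ∈ Q, p (y - x) ≤ ε}}, ?_, ?_, ?_⟩
  · rintro z ⟨δ, hδ, hz⟩
    refine hz fun p hp => ?_
    rw [sub_self, (hP p (hQ hp)).isSublinear.map_zero]
    exact hδ.nonneg
  · rintro z ⟨δ, hδ, hz⟩
    obtain ⟨δ', hδ', h2⟩ := hδ.exists_half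
    refine ⟨Q, δ', hQ, hQf, hδ', fun w hw => ⟨δ', hδ', fun y hy => hz fun p hp => ?_⟩⟩
    have h := (hP p (hQ hp)).add_le (y - w) (w - z)
    rw [sub_add_sub_cancel] at h
    exact (h.trans (add_le_add (hy p hp) (hw p hp))).trans h2.le
  · exact ⟨ε, hε, subset_rfl⟩

theorem isL0Seminorm_abs : IsL0Seminorm (fun ξ : L0 μ => |ξ|) where
  nonneg := abs_nonneg
  smul ξ x := by
    apply AEEqFun.ext
    filter_upwards [AEEqFun.coeFn_abs (ξ • x), AEEqFun.coeFn_mul ξ x, AEEqFun.coeFn_abs ξ,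
      AEEqFun.coeFn_abs x, AEEqFun.coeFn_mul |ξ| |x|] with ω h1 h2 h3 h4 h5
    rw [h1, h5, Pi.mul_apply, h3, h4, smul_eq_mul, h2, Pi.mul_apply, abs_mul]
  add_le := abs_add_le

theorem tcL0_ball_mem_nhds {ε : L0 μ} (hε : IsPosOn ε) (ξ : L0 μ) :
    {η : L0 μ | |η - ξ| ≤ ε} ∈ @nhds (L0 μ) (tcL0 μ) ξ := by
  have h := tc_ball_mem_nhds (P := {fun ξ : L0 μ => |ξ|}) (Q := {fun ξ : L0 μ => |ξ|})
    (by rintro p rfl; exact isL0Seminorm_abs) subset_rfl (Set.finite_singleton _) hε ξ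
  simpa using h

/-- `q` is an `L⁰`-seminorm which is continuous at `0` for `𝒯_c`. -/
structure IsTcSeminorm (P : Set (E → L0 μ)) (q : E → L0 μ) : Prop where
  seminorm : IsL0Seminorm q
  small : ∀ ε : L0 μ, IsPosOn ε → ∃ (Q : Set (E → L0 μ)) (δ : L0 μ), Q ⊆ P ∧ Q.Finite ∧
    IsPosOn δ ∧ ∀ y, (∀ p ∈ Q, p y ≤ δ) → q y ≤ ε

namespace IsTcSeminorm

variable {P : Set (E → L0 μ)}

theorem of_mem (hP : ∀ p ∈ P, IsL0Seminorm p) {p : E → L0 μ} (hp : p ∈ P) : IsTcSeminorm P p :=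
  ⟨hP p hp, fun ε hε => ⟨{p}, ε, by simpa using hp, Set.finite_singleton p, hε, by simp⟩⟩

theorem zero : IsTcSeminorm P (fun _ => 0) :=
  ⟨⟨fun _ => le_rfl, fun _ _ => by simp, fun _ _ => by simp⟩, fun ε hε =>
    ⟨∅, ε, by simp, Set.finite_empty, hε, fun _ _ => hε.nonneg⟩⟩

theorem add {p q : E → L0 μ} (hp : IsTcSeminorm P p) (hq : IsTcSeminorm P q) :
    IsTcSeminorm P (fun x => p x + q x) := by
  refine ⟨⟨fun x => add_nonneg (hp.1.1 x) (hq.1.1 x), fun ξ x => ?_, fun x y => ?_⟩,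
    fun ε hε => ?_⟩
  · simp only [hp.1.2, hq.1.2, mul_add]
  · rw [add_add_add_comm]
    exact add_le_add (hp.1.3 x y) (hq.1.3 x y)
  · obtain ⟨δ, hδ, rfl⟩ := hε.exists_half
    obtain ⟨Q, a, hQ, hQf, ha, h1⟩ := hp.2 δ hδ
    obtain ⟨R, b, hR, hRf, hb, h2⟩ := hq.2 δ hδ
    refine ⟨Q ∪ R, a ⊓ b, Set.union_subset hQ hR, hQf.union hRf, ha.inf hb, fun y hy => ?_⟩
    exact add_le_add (h1 y fun p hp => (hy p (Or.inl hp)).trans inf_le_left)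
      (h2 y fun p hp => (hy p (Or.inr hp)).trans inf_le_right)

theorem const_mul {q : E → L0 μ} (hq : IsTcSeminorm P q) {c : L0 μ} (hc : 0 ≤ c) :
    IsTcSeminorm P (fun x => c * q x) := by
  refine ⟨⟨fun x => mul_nonneg hc (hq.1.1 x), fun ξ x => ?_, fun x y => ?_⟩, fun ε hε => ?_⟩
  · simp only [hq.1.2]
    ring
  · rw [← mul_add]
    exact mul_le_mul_of_nonneg_left (hq.1.3 x y) hc
  -- Adding `1` keeps the denominator positive where `c` vanishes.
  · have hm : Measurable fun ω => ε ω / (c ω + 1) :=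
      ε.measurable.div (c.measurable.add measurable_const)
    have hmk := AEEqFun.coeFn_mk _ hm.aestronglyMeasurable (μ := μ)
    obtain ⟨Q, δ, hQ, hQf, hδ, h⟩ := hq.2 (AEEqFun.mk _ hm.aestronglyMeasurable) (by
      filter_upwards [hmk, hε, ae_nonneg hc] with ω h1 h2 h3
      rw [h1]
      positivity)
    refine ⟨Q, δ, hQ, hQf, hδ, fun y hy => (mul_le_mul_of_nonneg_left (h y hy) hc).trans ?_⟩
    rw [← AEEqFun.coeFn_le]
    filter_upwards [hmk, hε, ae_nonneg hc,
      AEEqFun.coeFn_mul c (AEEqFun.mk _ hm.aestronglyMeasurable)] with ω h1 h2 h3 h4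
    rw [h4, Pi.mul_apply, h1, ← mul_div_assoc, div_le_iff₀ (by positivity)]
    nlinarith

theorem sum (hP : ∀ p ∈ P, IsL0Seminorm p) (s : Finset (E → L0 μ)) (hs : ∀ p ∈ s, p ∈ P) :
    IsTcSeminorm P (fun x => ∑ p ∈ s, p x) := by
  classical
  induction s using Finset.induction_on with
  | empty => simpa using zero
  | insert p s hp ih =>
    simp only [Finset.sum_insert hp]
    exact (of_mem hP (hs p (Finset.mem_insert_self p s))).add
      (ih fun q hq => hs q (Finset.mem_insert_of_mem hq))

/-- A linear map dominated by a continuous seminorm is continuous. -/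
theorem continuous_of_le {q : E → L0 μ} (hq : IsTcSeminorm P q)
    (g : E →ₗ[Ω →ₘ[μ] ℝ] (Ω →ₘ[μ] ℝ)) (hg : ∀ x, g x ≤ q x) : Continuous[tc P, tcL0 μ] g := by
  let := tc P
  let := tcL0 μ
  refine ⟨fun G hG x hx => ?_⟩
  obtain ⟨R, ε, hR, -, hε, hRG⟩ := hG (g x) hx
  obtain ⟨Q, δ, hQ, hQf, hδ, h⟩ := hq.2 ε hε
  refine ⟨Q, δ, hQ, hQf, hδ, fun y hy => hRG fun p hp => ?_⟩
  obtain rfl : p = fun ξ : L0 μ => |ξ| := hR hp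
  have h1 : |g (y - x)| ≤ q (y - x) := abs_le'.2 ⟨hg _, by
    rw [← map_neg, ← hq.1.map_neg]
    exact hg _⟩
  change |g y - g x| ≤ ε
  rw [← map_sub]
  exact h1.trans (h _ hy)

end IsTcSeminorm

/-- If `f_B` is lower semicontinuous and `f(x) > r` on `B`, then `f > r` on a ball around `x`, on
a nonnull part of `B`. -/
theorem exists_ball_lt [IsFiniteMeasure μ] {P : Set (E → L0 μ)} (hP : ∀ p ∈ P, IsL0Seminorm p)
    (hE : HasCCP (μ := μ) (Set.univ : Set E)) {f : E → LBar0 μ} (hf : IsLocal f) {B : Set Ω}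
    (hB : MeasurableSet B) (hlsc : LscOn P f B hB) (hμB : 0 < μ B) (x : E) (r : L0 μ)
    (hr : ∀ᵐ ω ∂μ, ω ∈ B → ((r ω : ℝ) : EReal) < f x ω) :
    ∃ q : E → L0 μ, IsTcSeminorm P q ∧ ∃ ε : L0 μ, IsPosOn ε ∧ ∃ B' ⊆ B, MeasurableSet B' ∧
      0 < μ B' ∧ ∀ y, ∀ᵐ ω ∂μ, ω ∈ B' → q (y - x) ω ≤ ε ω → ((r ω : ℝ) : EReal) < f y ω := by
  let t1 := TopologicalSpace.induced (Subtype.val : stratum μ E B hB → E) (tc P)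
  let t2 := TopologicalSpace.induced (Subtype.val : stratum μ (L0 μ) B hB → L0 μ) (tcL0 μ)
  have hclosed : IsClosed (epiOn f B hB) := hlsc
  let r' : stratum μ (L0 μ) B hB := ⟨(ind B hB : L0 μ) • r, r, rfl⟩
  have hr' : ∀ᵐ ω ∂μ, ω ∈ B → (r' : L0 μ) ω = r ω := by
    filter_upwards [AEEqFun.coeFn_mul (ind B hB : L0 μ) r, ae_ind_of_mem (μ := μ) B hB]
      with ω h1 h2 hω
    change ((ind B hB : L0 μ) * r) ω = r ω
    rw [h1, Pi.mul_apply, h2 hω, one_mul]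
  have hopen : IsOpen {y : stratum μ E B hB | (y, r') ∉ epiOn f B hB} :=
    (hclosed.preimage (Continuous.prodMk_left r')).isOpen_compl
  obtain ⟨G, hG, hGeq⟩ := (@isOpen_induced_iff _ _ (tc P) _ _).1 hopen
  have hxG : (ind B hB : L0 μ) • x ∈ G := by
    have : (⟨(ind B hB : L0 μ) • x, x, rfl⟩ : stratum μ E B hB) ∈
        {y : stratum μ E B hB | (y, r') ∉ epiOn f B hB} := by
      intro hmem
      refine hμB.ne' (measure_eq_zero_iff_ae_notMem.2 ?_)
      filter_upwards [hr, hr', hmem, hf x B hB] with ω h1 h2 h3 h4 hω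
      have h5 := h3 hω
      rw [h2 hω] at h5
      exact absurd ((h1 hω).trans_eq (h4 hω)) (not_lt.2 h5)
    rw [← hGeq] at this
    exact this
  obtain ⟨Q, ε, hQ, hQf, hε, hball⟩ := hG _ hxG
  have hQs : ∀ p ∈ Q, IsL0Seminorm p := fun p hp => hP p (hQ hp)
  -- The bad event of `y`: inside the ball, yet not above `r`. Concatenation yields `z` whose bad
  -- event contains all others a.s.
  let Φ : E → Ω → Prop := fun y ω =>
    ω ∈ B ∧ f y ω ≤ ((r ω : ℝ) : EReal) ∧ ∀ p ∈ Q, p (y - x) ω ≤ ε ω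
  have hΦm : ∀ y, MeasurableSet {ω | Φ y ω} := fun y => by
    refine hB.inter (MeasurableSet.inter
      (measurableSet_le (f y).measurable (measurable_coe_real_ereal.comp r.measurable)) ?_)
    have : {ω | ∀ p ∈ Q, p (y - x) ω ≤ ε ω} = ⋂ p ∈ Q, {ω | p (y - x) ω ≤ ε ω} := by
      ext; simp
    change MeasurableSet {ω | ∀ p ∈ Q, p (y - x) ω ≤ ε ω}
    rw [this]
    exact MeasurableSet.biInter hQf.countable fun p _ =>
      measurableSet_le (p (y - x)).measurable ε.measurable
  obtain ⟨z, hz⟩ := exists_forall_ae_imp hE Φ hΦm (by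
    intro A hA u v huv
    have hp : ∀ᵐ ω ∂μ, ∀ p ∈ Q, ω ∈ A → p (u - x) ω = p (v - x) ω :=
      (ae_ball_iff hQf.countable).2 fun p hp => (hQs p hp).ae_sub_eq huv x
    filter_upwards [hf.ae_eq huv, hp] with ω h1 h2 hω hu
    exact ⟨hu.1, (h1 hω) ▸ hu.2.1, fun p hp => (h2 p hp hω) ▸ hu.2.2 p hp⟩)
  let q : E → L0 μ := fun y => ∑ p ∈ hQf.toFinset, p y
  have hq : IsTcSeminorm P q := IsTcSeminorm.sum hP _ fun p hp => hQ (hQf.mem_toFinset.1 hp)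
  have hpq : ∀ p ∈ Q, ∀ y, p y ≤ q y := fun p hp y =>
    Finset.single_le_sum (f := fun p : E → L0 μ => p y)
      (fun p hp => (hQs p (hQf.mem_toFinset.1 hp)).nonneg y) (hQf.mem_toFinset.2 hp)
  -- If `z` were bad a.s. on `B`, then `I_B z` would lie in the ball and also in the epigraph slice
  -- at `r'`, which the ball avoids. Hence the remaining event is nonnull, and no `y` is bad on it.
  refine ⟨q, hq, ε, hε, B \ {ω | Φ z ω}, Set.sdiff_subset, hB.diff (hΦm z), ?_, fun y => ?_⟩
  · rw [pos_iff_ne_zero]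
    intro h0
    rw [measure_eq_zero_iff_ae_notMem] at h0
    have hzG : (ind B hB : L0 μ) • z ∈ G := by
      refine hball fun p hp => ?_
      rw [← smul_sub, ← AEEqFun.coeFn_le]
      filter_upwards [(hQs p hp).ae_ind_smul B hB (z - x), h0, hε] with ω h1 h2 h3
      rw [h1]
      by_cases hω : ω ∈ B
      · rw [Set.indicator_of_mem hω]
        by_contra hcon
        exact h2 ⟨hω, fun h => hcon (h.2.2 p hp)⟩
      · rw [Set.indicator_of_notMem hω]
        exact h3.le
    have hmem : (⟨(ind B hB : L0 μ) • z, z, rfl⟩ : stratum μ E B hB) ∈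
        {y : stratum μ E B hB | (y, r') ∉ epiOn f B hB} := by
      rw [← hGeq]
      exact hzG
    refine hmem ?_
    filter_upwards [h0, hr', hf z B hB] with ω h1 h2 h3 hω
    rw [h2 hω, ← h3 hω]
    by_contra hcon
    exact h1 ⟨hω, fun h => hcon h.2.1⟩
  · have hall : ∀ᵐ ω ∂μ, ∀ p ∈ Q, p (y - x) ω ≤ q (y - x) ω :=
      (ae_ball_iff hQf.countable).2 fun p hp => AEEqFun.coeFn_le.2 (hpq p hp _)
    filter_upwards [hz y, hall] with ω h1 h2 hω hle
    by_contra hcon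
    exact hω.2 (h1 ⟨hω.1, not_lt.1 hcon, fun p hp => (h2 p hp).trans hle⟩)

end Topology

/-! ### Extended real arithmetic. -/

section ExtendedReals

theorem le_addTop_left_zero (b : EReal) : b ≤ addTop 0 b := by
  unfold addTop
  split_ifs <;> simp

theorem le_addTop_right_zero (b : EReal) : b ≤ addTop b 0 := by
  unfold addTop
  split_ifs <;> simp

/-- The pointwise form of convexity of a supremum of affine functions. The weights `0` and `1` are
separated because `0 * ⊤ = 0`; for interior weights an infinite `u` or `v` allowed by the bounds
makes the right side `⊤`. -/
theorem coe_sub_le_addTop {a b t : ℝ} {c u v : EReal} (ht0 : 0 ≤ t) (ht1 : t ≤ 1)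
    (hu : (a : EReal) - c ≤ u) (hv : (b : EReal) - c ≤ v) :
    ((t * a + (1 - t) * b : ℝ) : EReal) - c ≤
      addTop ((t : EReal) * u) (((1 - t : ℝ) : EReal) * v) := by
  rcases ht0.eq_or_lt with rfl | ht0
  · simpa using hv.trans (le_addTop_left_zero v)
  rcases ht1.eq_or_lt with rfl | ht1
  · simpa using hu.trans (le_addTop_right_zero u)
  have ht1' : 0 < 1 - t := sub_pos.2 ht1
  induction c with
  | top => simp
  | bot =>
    rw [EReal.coe_sub_bot, top_le_iff] at hu
    simp [addTop, hu, EReal.coe_mul_top_of_pos ht0]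
  | coe c =>
    rw [← EReal.coe_sub] at hu hv
    induction u with
    | top => simp [addTop, EReal.coe_mul_top_of_pos ht0]
    | bot => exact absurd (le_bot_iff.1 hu) (EReal.coe_ne_bot _)
    | coe u =>
      induction v with
      | top =>
        rw [EReal.coe_mul_top_of_pos ht1']
        simp [addTop]
      | bot => exact absurd (le_bot_iff.1 hv) (EReal.coe_ne_bot _)
      | coe v =>
        rw [EReal.coe_le_coe_iff] at hu hv
        rw [addTop, ← EReal.coe_mul, ← EReal.coe_mul,
          if_neg (not_or.2 ⟨EReal.coe_ne_top _, EReal.coe_ne_top _⟩), ← EReal.coe_sub,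
          ← EReal.coe_add, EReal.coe_le_coe_iff]
        nlinarith

theorem coe_sub_coe_sub_cancel (a : ℝ) (b : EReal) : (a : EReal) - ((a : EReal) - b) = b := by
  induction b with
  | top => simp
  | bot => simp
  | coe b => norm_cast; ring

theorem eq_top_of_coe_sub_le_bot {a : ℝ} {c : EReal} (h : (a : EReal) - c ≤ ⊥) : c = ⊤ := by
  induction c with
  | top => rfl
  | bot => simp at h
  | coe c => exact absurd (le_bot_iff.1 h) (EReal.coe_ne_bot (a - c))

theorem measurable_addTop {Ω : Type*} [MeasurableSpace Ω] {u v : Ω → EReal} (hu : Measurable u)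
    (hv : Measurable v) : Measurable fun ω => addTop (u ω) (v ω) :=
  Measurable.ite ((hu (measurableSet_singleton ⊤)).union (hv (measurableSet_singleton ⊤)))
    measurable_const (hu.add hv)

end ExtendedReals

/-! ### Localized bounds for essential suprema. -/

section EssentialSupremum

variable {Ω : Type*} [MeasurableSpace Ω] {μ : Measure Ω}

theorem ae_subBar (ξ : L0 μ) (η : LBar0 μ) :
    ∀ᵐ ω ∂μ, subBar ξ η ω = ((ξ ω : ℝ) : EReal) - η ω :=
  AEEqFun.coeFn_comp₂Measurable _ _ _ _

variable [IsFiniteMeasure μ]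

theorem ae_le_esup {S : Set (LBar0 μ)} {ζ : LBar0 μ} (hζ : ζ ∈ S) : ∀ᵐ ω ∂μ, ζ ω ≤ esup S ω :=
  AEEqFun.coeFn_le.2 ((isLUB_esup S).1 hζ)

theorem ae_esup_le_on {S : Set (LBar0 μ)} {B : Set Ω} (hB : MeasurableSet B) {c : Ω → EReal}
    (hc : Measurable c) (h : ∀ ζ ∈ S, ∀ᵐ ω ∂μ, ω ∈ B → ζ ω ≤ c ω) :
    ∀ᵐ ω ∂μ, ω ∈ B → esup S ω ≤ c ω := by
  classical
  -- Extending the bound by `⊤` off `B` makes it a global upper bound.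
  have hm : Measurable fun ω => if ω ∈ B then c ω else ⊤ := hc.ite hB measurable_const
  have hmk := AEEqFun.coeFn_mk _ hm.aestronglyMeasurable (μ := μ)
  have hle : esup S ≤ AEEqFun.mk _ hm.aestronglyMeasurable := (isLUB_esup S).2 (by
    intro ζ hζ
    rw [← AEEqFun.coeFn_le]
    filter_upwards [hmk, h ζ hζ] with ω h1 h2
    rw [h1]
    split_ifs with hω
    · exact h2 hω
    · exact le_top)
  filter_upwards [hmk, AEEqFun.coeFn_le.2 hle] with ω h1 h2 hω
  rwa [h1, if_pos hω] at h2

end EssentialSupremum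

/-! ### Biconjugates are closed minorants. -/

section Biconjugate

variable {Ω : Type*} [MeasurableSpace Ω] {μ : Measure Ω} [IsFiniteMeasure μ]
variable {E : Type*} [AddCommGroup E] [Module (Ω →ₘ[μ] ℝ) E] {P : Set (E → L0 μ)}
variable {f : E → LBar0 μ}

theorem ae_sub_le_conjC (f : E → LBar0 μ) (g : DualC P) (x : E) :
    ∀ᵐ ω ∂μ, ((g.1 x ω : ℝ) : EReal) - f x ω ≤ conjC P f g ω := by
  filter_upwards [ae_le_esup (S := Set.range fun x : E => subBar (g.1 x) (f x)) ⟨x, rfl⟩,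
    ae_subBar (g.1 x) (f x)] with ω h1 h2
  rwa [h2] at h1

theorem ae_sub_le_biconjC (f : E → LBar0 μ) (g : DualC P) (x : E) :
    ∀ᵐ ω ∂μ, ((g.1 x ω : ℝ) : EReal) - conjC P f g ω ≤ biconjC P f x ω := by
  filter_upwards [ae_le_esup (S := Set.range fun g : DualC P => subBar (g.1 x) (conjC P f g))
    ⟨g, rfl⟩, ae_subBar (g.1 x) (conjC P f g)] with ω h1 h2
  rwa [h2] at h1

theorem ae_conjC_le_on {B : Set Ω} (hB : MeasurableSet B) {c : Ω → EReal} (hc : Measurable c)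
    {g : DualC P} (h : ∀ x, ∀ᵐ ω ∂μ, ω ∈ B → ((g.1 x ω : ℝ) : EReal) - f x ω ≤ c ω) :
    ∀ᵐ ω ∂μ, ω ∈ B → conjC P f g ω ≤ c ω := by
  refine ae_esup_le_on hB hc ?_
  rintro _ ⟨x, rfl⟩
  filter_upwards [h x, ae_subBar (g.1 x) (f x)] with ω h1 h2
  rwa [h2]

theorem ae_biconjC_le_on {B : Set Ω} (hB : MeasurableSet B) {c : Ω → EReal} (hc : Measurable c)
    {x : E} (h : ∀ g : DualC P, ∀ᵐ ω ∂μ, ω ∈ B →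
      ((g.1 x ω : ℝ) : EReal) - conjC P f g ω ≤ c ω) :
    ∀ᵐ ω ∂μ, ω ∈ B → biconjC P f x ω ≤ c ω := by
  refine ae_esup_le_on hB hc ?_
  rintro _ ⟨g, rfl⟩
  filter_upwards [h g, ae_subBar (g.1 x) (conjC P f g)] with ω h1 h2
  rwa [h2]

theorem biconjC_le (P : Set (E → L0 μ)) (f : E → LBar0 μ) : biconjC P f ≤ f := by
  intro x
  rw [← AEEqFun.coeFn_le]
  have h := ae_biconjC_le_on (P := P) (f := f) (x := x) MeasurableSet.univ (f x).measurable
    fun g => by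
      filter_upwards [ae_sub_le_conjC f g x] with ω h1 _
      calc _ ≤ ((g.1 x ω : ℝ) : EReal) - (((g.1 x ω : ℝ) : EReal) - f x ω) :=
            EReal.sub_le_sub le_rfl h1
        _ = f x ω := coe_sub_coe_sub_cancel _ _
  filter_upwards [h] with ω h
  exact h trivial

theorem biconjC_mono {k : E → LBar0 μ} (hk : k ≤ f) : biconjC P k ≤ biconjC P f := by
  intro x
  rw [← AEEqFun.coeFn_le]
  have hconj : ∀ g : DualC P, ∀ᵐ ω ∂μ, ω ∈ Set.univ → conjC P f g ω ≤ conjC P k g ω := fun g =>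
    ae_conjC_le_on MeasurableSet.univ (conjC P k g).measurable fun y => by
      filter_upwards [ae_sub_le_conjC k g y, AEEqFun.coeFn_le.2 (hk y)] with ω h1 h2 _
      exact (EReal.sub_le_sub le_rfl h2).trans h1
  have h := ae_biconjC_le_on (P := P) (f := k) (x := x) MeasurableSet.univ
    (biconjC P f x).measurable fun g => by
      filter_upwards [hconj g, ae_sub_le_biconjC f g x] with ω h1 h2 _
      exact (EReal.sub_le_sub le_rfl (h1 trivial)).trans h2
  filter_upwards [h] with ω h
  exact h trivial

theorem biconjC_isLocal (P : Set (E → L0 μ)) (f : E → LBar0 μ) : IsLocal (biconjC P f) := by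
  intro x A hA
  have h1 := ae_biconjC_le_on (P := P) (f := f) (x := x) hA
    (biconjC P f ((ind A hA : L0 μ) • x)).measurable fun g => by
      filter_upwards [ae_sub_le_biconjC f g ((ind A hA : L0 μ) • x), ae_linear_ind_smul g.1 A hA x]
        with ω h1 h2 hω
      rwa [h2 hω] at h1
  have h2 := ae_biconjC_le_on (P := P) (f := f) (x := (ind A hA : L0 μ) • x) hA
    (biconjC P f x).measurable fun g => by
      filter_upwards [ae_sub_le_biconjC f g x, ae_linear_ind_smul g.1 A hA x] with ω h1 h2 hω
      rwa [h2 hω]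
  filter_upwards [h1, h2] with ω h1 h2 hω
  exact le_antisymm (h1 hω) (h2 hω)

theorem biconjC_eq_bot_on_MI (P : Set (E → L0 μ)) (f : E → LBar0 μ) (x : E) :
    ∀ᵐ ω ∂μ, ω ∈ MI (biconjC P f) → biconjC P f x ω = ⊥ := by
  refine (isEssSupSet_essSupSet (μ := μ) (eventsMI (biconjC P f)) fun _ h => h.1).least
    {ω | biconjC P f x ω = ⊥} ((biconjC P f x).measurable (measurableSet_singleton ⊥)) ?_
  rintro A ⟨hA, y, hy⟩
  have h := ae_biconjC_le_on (P := P) (f := f) (x := x) (c := fun _ => ⊥) hA measurable_const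
    fun g => by
      filter_upwards [hy, ae_sub_le_biconjC f g y] with ω h1 h2 hω
      rw [h1 hω] at h2
      rw [eq_top_of_coe_sub_le_bot h2, EReal.sub_top]
  filter_upwards [h] with ω h hω
  exact le_bot_iff.1 (h hω)

theorem biconjC_convexOnEvent (P : Set (E → L0 μ)) (f : E → LBar0 μ) (A : Set Ω)
    (hA : MeasurableSet A) : ConvexOnEvent (biconjC P f) A hA := by
  intro x _ y _ ξ hξ0 hξ1
  refine ae_biconjC_le_on hA (measurable_addTop
    ((measurable_coe_real_ereal.comp ξ.measurable).mul (biconjC P f x).measurable)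
    ((measurable_coe_real_ereal.comp (measurable_const.sub ξ.measurable)).mul
      (biconjC P f y).measurable)) fun g => ?_
  have hg : g.1 (ξ • x + (1 - ξ) • y) = ξ * g.1 x + (1 - ξ) * g.1 y := by
    rw [map_add, map_smul, map_smul, smul_eq_mul, smul_eq_mul]
  filter_upwards [ae_sub_le_biconjC f g x, ae_sub_le_biconjC f g y, ae_nonneg hξ0,
    AEEqFun.coeFn_le.2 hξ1, AEEqFun.coeFn_one (μ := μ) (β := ℝ), AEEqFun.coeFn_mul ξ (g.1 x),
    AEEqFun.coeFn_mul (1 - ξ) (g.1 y), AEEqFun.coeFn_sub 1 ξ,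
    AEEqFun.coeFn_add (ξ * g.1 x) ((1 - ξ) * g.1 y)] with ω h1 h2 h3 h4 h5 h6 h7 h8 h9 _
  rw [h5] at h4
  have he : g.1 (ξ • x + (1 - ξ) • y) ω = ξ ω * g.1 x ω + (1 - ξ ω) * g.1 y ω := by
    rw [hg, h9, Pi.add_apply, h6, h7, Pi.mul_apply, Pi.mul_apply, h8, Pi.sub_apply, h5,
      Pi.one_apply]
  rw [he]
  exact coe_sub_le_addTop h3 h4 h1 h2

/-- The gap is `3 * δ` when `c` is finite, so moving each side by at most `δ` leaves a gap of at
least `δ`; for `c = ⊥` the right side is `⊤`. -/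
theorem coe_lt_coe_sub_of_abs_le {a a' r r' δ : ℝ} {c : EReal}
    (hδ : c = ⊥ ∨ δ = (a - c.toReal - r) / 3) (hδ0 : 0 < δ) (hc : (r : EReal) < (a : EReal) - c)
    (ha : |a' - a| ≤ δ) (hr : |r' - r| ≤ δ) : (r' : EReal) < (a' : EReal) - c := by
  induction c with
  | top => simp at hc
  | bot => simp
  | coe c =>
    rcases hδ with h | h
    · exact absurd h (EReal.coe_ne_bot _)
    rw [EReal.toReal_coe] at h
    rw [← EReal.coe_sub, EReal.coe_lt_coe_iff]
    have h1 := (abs_le.1 ha).1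
    have h2 := (abs_le.1 hr).2
    linarith

theorem biconjC_lscOn (P : Set (E → L0 μ)) (f : E → LBar0 μ) (A : Set Ω) (hA : MeasurableSet A) :
    LscOn P (biconjC P f) A hA := by
  classical
  let t1 := TopologicalSpace.induced (Subtype.val : stratum μ E A hA → E) (tc P)
  let t2 := TopologicalSpace.induced (Subtype.val : stratum μ (L0 μ) A hA → L0 μ) (tcL0 μ)
  change IsClosed (epiOn (biconjC P f) A hA)
  rw [← isOpen_compl_iff, isOpen_iff_mem_nhds]
  rintro ⟨x, r⟩ hxr
  -- A point outside the epigraph is already excluded by a single affine function, so it suffices to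
  -- perturb that one.
  have hex : ∃ g : DualC P, ¬ ∀ᵐ ω ∂μ, ω ∈ A →
      ((g.1 x ω : ℝ) : EReal) - conjC P f g ω ≤ (((r : L0 μ) ω : ℝ) : EReal) := by
    by_contra! hcon
    exact hxr (ae_biconjC_le_on hA
      (measurable_coe_real_ereal.comp (L0.measurable (r : L0 μ))) hcon)
  obtain ⟨g, hg⟩ := hex
  have hcm := (conjC P f g).measurable
  have hrm := L0.measurable (r : L0 μ)
  have hgm := L0.measurable (g.1 x)
  let B : Set Ω := {ω | (((r : L0 μ) ω : ℝ) : EReal) < ((g.1 x ω : ℝ) : EReal) - conjC P f g ω}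
  have hBm : MeasurableSet B := measurableSet_lt (measurable_coe_real_ereal.comp hrm)
    (measurable_coe_sub.comp (hgm.prodMk hcm))
  -- A random radius: one third of the gap where it is positive and finite, and `1` elsewhere, where
  -- any positive value will do.
  let d : Ω → ℝ := fun ω => if ω ∈ B ∩ {ω | conjC P f g ω ≠ ⊥} then
    (g.1 x ω - (conjC P f g ω).toReal - (r : L0 μ) ω) / 3 else 1
  have hdm : Measurable d := Measurable.ite
    (hBm.inter (hcm (measurableSet_singleton ⊥)).compl)
    (((hgm.sub (measurable_ereal_toReal.comp hcm)).sub hrm).div_const 3) measurable_const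
  have hdpos : ∀ ω, 0 < d ω := by
    intro ω
    by_cases h : ω ∈ B ∩ {ω | conjC P f g ω ≠ ⊥}
    · simp only [d, if_pos h]
      obtain ⟨h1, h2⟩ := h
      have h3 : conjC P f g ω ≠ ⊤ := fun h => by
        simp only [B, Set.mem_ofPred_eq, h, EReal.sub_top] at h1
        exact not_lt_bot h1
      have h4 : (((r : L0 μ) ω : ℝ) : EReal) <
          ((g.1 x ω - (conjC P f g ω).toReal : ℝ) : EReal) := by
        rw [EReal.coe_sub, EReal.coe_toReal h3 h2]
        exact h1
      rw [EReal.coe_lt_coe_iff] at h4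
      linarith
    · simp only [d, if_neg h]
      exact one_pos
  have hmk := AEEqFun.coeFn_mk d hdm.aestronglyMeasurable (μ := μ)
  have hε : IsPosOn (AEEqFun.mk d hdm.aestronglyMeasurable : L0 μ) := by
    filter_upwards [hmk] with ω h
    rw [h]
    exact hdpos ω
  set ε : L0 μ := AEEqFun.mk d hdm.aestronglyMeasurable
  have hU : {y : stratum μ E A hA | |g.1 (y : E) - g.1 (x : E)| ≤ ε} ∈ 𝓝 x := by
    have h := (@Continuous.continuousAt _ _ (tc P) (tcL0 μ) _ (x : E) g.2)
      (tcL0_ball_mem_nhds hε (g.1 (x : E)))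
    exact @Continuous.continuousAt _ _ t1 (tc P) Subtype.val x
      (@continuous_induced_dom _ _ Subtype.val (tc P)) _ h
  have hV : {s : stratum μ (L0 μ) A hA | |(s : L0 μ) - (r : L0 μ)| ≤ ε} ∈ 𝓝 r :=
    @Continuous.continuousAt _ _ t2 (tcL0 μ) Subtype.val r
      (@continuous_induced_dom _ _ Subtype.val (tcL0 μ)) _ (tcL0_ball_mem_nhds hε (r : L0 μ))
  refine Filter.mem_of_superset (prod_mem_nhds hU hV) ?_
  rintro ⟨y, s⟩ ⟨hy, hs⟩ hmem
  refine hg ?_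
  filter_upwards [hmem, ae_sub_le_biconjC f g (y : E), hmk, AEEqFun.coeFn_le.2 hy,
    AEEqFun.coeFn_le.2 hs, AEEqFun.coeFn_abs (g.1 (y : E) - g.1 (x : E)),
    AEEqFun.coeFn_abs ((s : L0 μ) - (r : L0 μ)), AEEqFun.coeFn_sub (g.1 (y : E)) (g.1 (x : E)),
    AEEqFun.coeFn_sub (s : L0 μ) (r : L0 μ)] with ω h1 h2 h3 h4 h5 h6 h7 h8 h9 hω
  by_contra hcon
  have hωB : ω ∈ B := not_le.1 hcon
  rw [h3, h6, h8] at h4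
  rw [h3, h7, h9] at h5
  refine absurd (h2.trans (h1 hω)) (not_le.2 ?_)
  refine coe_lt_coe_sub_of_abs_le ?_ (hdpos ω) hωB h4 h5
  by_cases h : conjC P f g ω = ⊥
  · exact Or.inl h
  · exact Or.inr (if_pos ⟨hωB, h⟩)

theorem biconjC_isTcClosed (P : Set (E → L0 μ)) (f : E → LBar0 μ) :
    IsTcClosed P (biconjC P f) :=
  ⟨biconjC_isLocal P f, biconjC_eq_bot_on_MI P f, fun A hA _ _ _ =>
    ⟨biconjC_convexOnEvent P f A hA, biconjC_lscOn P f A hA⟩⟩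

end Biconjugate

/-! ### Values on `BP` and `PI`. -/

section ExtremalEvents

variable {Ω : Type*} [MeasurableSpace Ω] {μ : Measure Ω} [IsFiniteMeasure μ] {E : Type*}

theorem measurableSet_BP (k : E → LBar0 μ) : MeasurableSet (BP k) :=
  ((isEssSupSet_essSupSet (μ := μ) (eventsMI k) fun _ h => h.1).measurable.union
    (isEssSupSet_essSupSet (μ := μ) (eventsPI k) fun _ h => h.1).measurable).compl

theorem ae_bot_lt_on_BP (k : E → LBar0 μ) (x : E) : ∀ᵐ ω ∂μ, ω ∈ BP k → ⊥ < k x ω := by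
  filter_upwards [(isEssSupSet_essSupSet (μ := μ) (eventsMI k) fun _ h => h.1).subset
    {ω | k x ω = ⊥} ⟨(k x).measurable (measurableSet_singleton ⊥), x, ae_of_all _ fun _ h => h⟩]
    with ω h hω
  exact bot_lt_iff_ne_bot.2 fun hbot => hω (Or.inl (h hbot))

theorem ae_eq_top_on_PI (k : E → LBar0 μ) (x : E) : ∀ᵐ ω ∂μ, ω ∈ PI k → k x ω = ⊤ :=
  (isEssSupSet_essSupSet (μ := μ) (eventsPI k) fun _ h => h.1).least {ω | k x ω = ⊤}
    ((k x).measurable (measurableSet_singleton ⊤)) fun _ hA => hA.2 x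

end ExtremalEvents

/-! ### Affine minorants and the Fenchel–Moreau inequality. -/

section FenchelMoreau

variable {Ω : Type*} [MeasurableSpace Ω] {μ : Measure Ω}
variable {E : Type*} [AddCommGroup E] [Module (Ω →ₘ[μ] ℝ) E] {P : Set (E → L0 μ)}
variable {k : E → LBar0 μ}

/-- Locality frees the inequality from the stratum: on `B`, replacing `x` by `I_B x` changes
nothing. -/
theorem ConvexOnEvent.ae_le (hk : IsLocal k) {B : Set Ω} {hB : MeasurableSet B}
    (h : ConvexOnEvent k B hB) (x y : E) {ξ : L0 μ} (h0 : 0 ≤ ξ) (h1 : ξ ≤ 1) :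
    ∀ᵐ ω ∂μ, ω ∈ B → k (ξ • x + (1 - ξ) • y) ω ≤
      addTop ((ξ ω : EReal) * k x ω) (((1 - ξ ω : ℝ) : EReal) * k y ω) := by
  have he : (ind B hB : L0 μ) • (ξ • x + (1 - ξ) • y) = (ind B hB : L0 μ) •
      (ξ • (ind B hB : L0 μ) • x + (1 - ξ) • (ind B hB : L0 μ) • y) := by
    rw [smul_add, smul_add, smul_comm _ ξ, smul_comm _ (1 - ξ), smul_comm _ ξ,
      smul_comm _ (1 - ξ), ind_smul_ind_smul, ind_smul_ind_smul]
  filter_upwards [hk.ae_eq he, hk x B hB, hk y B hB,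
    h _ ⟨x, rfl⟩ _ ⟨y, rfl⟩ ξ h0 h1] with ω h2 h3 h4 h5 hω
  rw [h2 hω, h3 hω, h4 hω]
  exact h5 hω

/-- With `t = ε / max ε d`, the hypothesis says `t * (a - b) < 1` for finite `b`, and `1 / t ≤ 1 +
ε⁻¹ * d`. -/
theorem coe_le_of_lt_addTop {a d ε : ℝ} {b : EReal} (hε : 0 < ε)
    (h : ((a - 1 : ℝ) : EReal) < addTop (((ε / max ε d : ℝ) : EReal) * b)
      (((1 - ε / max ε d : ℝ) : EReal) * (a : EReal))) (hd : 0 ≤ d) :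
    ((a - 1 - ε⁻¹ * d : ℝ) : EReal) ≤ b := by
  have hm : 0 < max ε d := lt_max_of_lt_left hε
  have ht : 0 < ε / max ε d := div_pos hε hm
  have ht' : ε / max ε d * max ε d = ε := div_mul_cancel₀ _ hm.ne'
  set t := ε / max ε d
  induction b with
  | top => exact le_top
  | bot =>
    rw [EReal.coe_mul_bot_of_pos ht, ← EReal.coe_mul, addTop,
      if_neg (not_or.2 ⟨bot_ne_top, EReal.coe_ne_top _⟩), EReal.bot_add] at h
    exact absurd h not_lt_bot
  | coe b =>
    rw [← EReal.coe_mul, ← EReal.coe_mul, addTop,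
      if_neg (not_or.2 ⟨EReal.coe_ne_top _, EReal.coe_ne_top _⟩), ← EReal.coe_add,
      EReal.coe_lt_coe_iff] at h
    rw [EReal.coe_le_coe_iff]
    have h1 : t * (a - b) < 1 := by linarith
    have h2 : ε * (a - b) ≤ max ε d := by
      calc ε * (a - b) = t * (a - b) * max ε d := by rw [mul_right_comm, ht']
        _ ≤ 1 * max ε d := mul_le_mul_of_nonneg_right h1.le hm.le
        _ = max ε d := one_mul _
    have h3 : max ε d ≤ ε + d := max_le (by linarith) (by linarith)
    have h4 : a - b ≤ ε⁻¹ * (ε + d) := by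
      rw [inv_mul_eq_div, le_div_iff₀ hε]
      linarith
    have h5 : ε⁻¹ * (ε + d) = 1 + ε⁻¹ * d := by field_simp
    linarith

/-- A convex function which is bounded below on a ball around a point of finiteness decreases at
most linearly. -/
theorem ae_le_of_convex_of_ball (hk : IsLocal k) {B : Set Ω} {hB : MeasurableSet B}
    (h : ConvexOnEvent k B hB) {q : E → L0 μ} (hq : IsL0Seminorm q) {ε a : L0 μ}
    (hε : IsPosOn ε) {x : E} (ha : ∀ᵐ ω ∂μ, ω ∈ B → k x ω = ((a ω : ℝ) : EReal))
    (hball : ∀ y, ∀ᵐ ω ∂μ, ω ∈ B → q (y - x) ω ≤ ε ω → ((a ω - 1 : ℝ) : EReal) < k y ω) (y : E) :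
    ∀ᵐ ω ∂μ, ω ∈ B → ((a ω - 1 - (ε ω)⁻¹ * q (y - x) ω : ℝ) : EReal) ≤ k y ω := by
  -- The weight that pulls `y` towards `x` into the ball, and leaves it fixed where it is already
  -- inside.
  have hm : Measurable fun ω => ε ω / max (ε ω) (q (y - x) ω) :=
    ε.measurable.div (ε.measurable.max (L0.measurable _))
  have hmk := AEEqFun.coeFn_mk _ hm.aestronglyMeasurable (μ := μ)
  set t : L0 μ := AEEqFun.mk _ hm.aestronglyMeasurable
  have ht0 : 0 ≤ t := nonneg_of_ae (by
    filter_upwards [hmk, hε] with ω h1 h2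
    rw [h1]
    exact div_nonneg h2.le (le_max_of_le_left h2.le))
  have ht1 : t ≤ 1 := by
    rw [← AEEqFun.coeFn_le]
    filter_upwards [hmk, hε, AEEqFun.coeFn_one (μ := μ) (β := ℝ)] with ω h1 h2 h3
    rw [h1, h3]
    exact div_le_one_of_le₀ (le_max_left _ _) (le_max_of_le_left h2.le)
  have hz : t • y + (1 - t) • x - x = t • (y - x) := by
    rw [sub_smul, one_smul, smul_sub]
    abel
  have hqz : q (t • y + (1 - t) • x - x) = t * q (y - x) := by
    rw [hz, hq.smul, abs_of_nonneg ht0]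
  filter_upwards [hball (t • y + (1 - t) • x), h.ae_le hk y x ht0 ht1, hmk, ha, hε,
    AEEqFun.coeFn_mul t (q (y - x)), ae_nonneg (hq.nonneg (y - x))] with ω h1 h2 h3 h4 h5 h6 h7 hω
  have hle : q (t • y + (1 - t) • x - x) ω ≤ ε ω := by
    rw [hqz, h6, Pi.mul_apply, h3, div_mul_eq_mul_div, div_le_iff₀ (lt_max_of_lt_left h5)]
    exact mul_le_mul_of_nonneg_left (le_max_right _ _) h5.le
  have h8 := (h1 hω hle).trans_le (h2 hω)
  rw [h3, h4 hω] at h8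
  exact coe_le_of_lt_addTop h5 h8 h7

/-- A local function that is convex on `B`, majorizes `r - q(· - x)` on `B` for a continuous
seminorm `q`, and is finite somewhere on `B`, has a continuous affine minorant on `B` taking the
value `r` at `x`. -/
theorem exists_dual_conjC_le [IsFiniteMeasure μ] (hk : IsLocal k) {B : Set Ω}
    {hB : MeasurableSet B} (hconv : ConvexOnEvent k B hB) {q : E → L0 μ} (hq : IsTcSeminorm P q)
    {x y₀ : E} {r : L0 μ} (hbot : ∀ y, ∀ᵐ ω ∂μ, ω ∈ B → ⊥ < k y ω)
    (hy₀ : ∀ᵐ ω ∂μ, ω ∈ B → k y₀ ω < ⊤)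
    (hle : ∀ y, ∀ᵐ ω ∂μ, ω ∈ B → ((r ω - q (y - x) ω : ℝ) : EReal) ≤ k y ω) :
    ∃ g : DualC P, ∀ᵐ ω ∂μ, ω ∈ B → conjC P k g ω ≤ ((g.1 x ω - r ω : ℝ) : EReal) := by
  classical
  -- The epigraph over `B`, translated so that `(x, r)` becomes the origin. Nonnegativity off `B`
  -- keeps `C` above `-q` on all of `Ω`.
  let C : Set (E × L0 μ) := {u | (∀ᵐ ω ∂μ, ω ∈ B → k (x + u.1) ω ≤ ((u.2 ω + r ω : ℝ) : EReal)) ∧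
    ∀ᵐ ω ∂μ, ω ∉ B → 0 ≤ u.2 ω}
  have hmem : ∀ z, (∀ᵐ ω ∂μ, ω ∈ B → k z ω < ⊤) → ∃ s : L0 μ, (z - x, s) ∈ C ∧
      ∀ᵐ ω ∂μ, ω ∈ B → k z ω = ((s ω + r ω : ℝ) : EReal) := by
    intro z hz
    have hm : Measurable fun ω => if ω ∈ B then (k z ω).toReal - r ω else 0 :=
      ((measurable_ereal_toReal.comp (k z).measurable).sub r.measurable).ite hB measurable_const
    have hmk := AEEqFun.coeFn_mk _ hm.aestronglyMeasurable (μ := μ)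
    have heq : ∀ᵐ ω ∂μ, ω ∈ B → k z ω =
        (((AEEqFun.mk _ hm.aestronglyMeasurable : L0 μ) ω + r ω : ℝ) : EReal) := by
      filter_upwards [hmk, hz, hbot z] with ω h1 h2 h3 hω
      rw [h1, if_pos hω, sub_add_cancel, EReal.coe_toReal (h2 hω).ne (h3 hω).ne']
    refine ⟨AEEqFun.mk _ hm.aestronglyMeasurable, ⟨?_, ?_⟩, heq⟩
    · filter_upwards [heq] with ω h hω
      rw [add_sub_cancel]
      exact (h hω).le
    · filter_upwards [hmk] with ω h hω
      rw [h, if_neg hω]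
  have hCne : C.Nonempty := by
    obtain ⟨s, hs, -⟩ := hmem y₀ hy₀
    exact ⟨_, hs⟩
  have hCconv : ∀ u ∈ C, ∀ v ∈ C, ∀ ξ : L0 μ, 0 ≤ ξ → ξ ≤ 1 → ξ • u + (1 - ξ) • v ∈ C := by
    intro u hu v hv ξ h0 h1
    have hs : ∀ᵐ ω ∂μ, (ξ • u + (1 - ξ) • v).2 ω = ξ ω * u.2 ω + (1 - ξ ω) * v.2 ω := by
      filter_upwards [AEEqFun.coeFn_add (ξ * u.2) ((1 - ξ) * v.2), AEEqFun.coeFn_mul ξ u.2,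
        AEEqFun.coeFn_mul (1 - ξ) v.2, AEEqFun.coeFn_sub 1 ξ,
        AEEqFun.coeFn_one (μ := μ) (β := ℝ)] with ω h1 h2 h3 h4 h5
      change (ξ * u.2 + (1 - ξ) * v.2) ω = _
      rw [h1, Pi.add_apply, h2, h3, Pi.mul_apply, Pi.mul_apply, h4, Pi.sub_apply, h5,
        Pi.one_apply]
    have hξ1 : ∀ᵐ ω ∂μ, ξ ω ≤ 1 := by
      filter_upwards [AEEqFun.coeFn_le.2 h1, AEEqFun.coeFn_one (μ := μ) (β := ℝ)] with ω h2 h3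
      simpa [h3] using h2
    have hx : x + (ξ • u + (1 - ξ) • v).1 = ξ • (x + u.1) + (1 - ξ) • (x + v.1) := by
      rw [Prod.fst_add, Prod.smul_fst, Prod.smul_fst, smul_add, smul_add, sub_smul, sub_smul,
        one_smul]
      simp only [one_smul]
      abel
    refine ⟨?_, ?_⟩
    · rw [hx]
      filter_upwards [hs, hu.1, hv.1, hconv.ae_le hk (x + u.1) (x + v.1) h0 h1, ae_nonneg h0,
        hξ1, hbot (x + u.1), hbot (x + v.1)] with ω h2 h3 h4 h5 h6 h7 h8 h9 hω
      refine (h5 hω).trans ?_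
      rw [h2]
      have e1 := EReal.coe_toReal ((h3 hω).trans_lt (EReal.coe_lt_top _)).ne (h8 hω).ne'
      have e2 := EReal.coe_toReal ((h4 hω).trans_lt (EReal.coe_lt_top _)).ne (h9 hω).ne'
      have i1 := h3 hω
      have i2 := h4 hω
      rw [← e1, EReal.coe_le_coe_iff] at i1
      rw [← e2, EReal.coe_le_coe_iff] at i2
      rw [← e1, ← e2, ← EReal.coe_mul, ← EReal.coe_mul, addTop,
        if_neg (not_or.2 ⟨EReal.coe_ne_top _, EReal.coe_ne_top _⟩), ← EReal.coe_add,
        EReal.coe_le_coe_iff]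
      nlinarith [mul_le_mul_of_nonneg_left i1 h6, mul_le_mul_of_nonneg_left i2 (sub_nonneg.2 h7)]
    · filter_upwards [hs, hu.2, hv.2, ae_nonneg h0, hξ1] with ω h2 h3 h4 h5 h6 hω
      rw [h2]
      exact add_nonneg (mul_nonneg h5 (h3 hω)) (mul_nonneg (sub_nonneg.2 h6) (h4 hω))
  have hCq : ∀ u ∈ C, 0 ≤ u.2 + q u.1 := by
    intro u hu
    have h := hle (x + u.1)
    rw [add_sub_cancel_left] at h
    refine nonneg_of_ae ?_
    filter_upwards [h, hu.1, hu.2, AEEqFun.coeFn_add u.2 (q u.1),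
      ae_nonneg (hq.seminorm.nonneg u.1)] with ω h1 h2 h3 h4 h5
    rw [h4, Pi.add_apply]
    by_cases hω : ω ∈ B
    · have h6 := (h1 hω).trans (h2 hω)
      rw [EReal.coe_le_coe_iff] at h6
      linarith
    · exact add_nonneg (h3 hω) h5
  obtain ⟨g, hgq, hgC⟩ := exists_linear_le_of_convex hq.seminorm hCne hCconv hCq
  refine ⟨⟨g, hq.continuous_of_le g hgq⟩, ?_⟩
  have hgx := L0.measurable (g x)
  refine ae_conjC_le_on hB (measurable_coe_real_ereal.comp (hgx.sub r.measurable)) fun y => ?_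
  have hD : MeasurableSet {ω | k y ω < ⊤} := measurableSet_lt (k y).measurable measurable_const
  -- Only points finite on all of `B` give elements of `C`, so `y` is replaced by `y₀` where `k y =
  -- ⊤`; there `g y - k y = ⊥` and nothing is lost.
  obtain ⟨z, hz1, hz2⟩ := exists_glue (μ := μ) {ω | k y ω < ⊤} hD y y₀
  obtain ⟨s, hs, hsz⟩ := hmem z (by
    filter_upwards [hk.ae_eq hz1, hk.ae_eq hz2, hy₀] with ω h1 h2 h3 hω
    by_cases h : k y ω < ⊤
    · rw [h1 h]
      exact h
    · rw [h2 h]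
      exact h3 hω)
  have hgs := hgC _ hs
  rw [map_sub] at hgs
  filter_upwards [hk.ae_eq hz1, ae_linear_eq g hz1, hsz, AEEqFun.coeFn_le.2 hgs,
    AEEqFun.coeFn_sub (g z) (g x)] with ω h1 h2 h3 h4 h5 hω
  by_cases h : k y ω < ⊤
  · rw [← h1 h, h3 hω]
    change ((g y ω : ℝ) : EReal) - _ ≤ ((g x ω - r ω : ℝ) : EReal)
    rw [h5, Pi.sub_apply, h2 h] at h4
    rw [← EReal.coe_sub, EReal.coe_le_coe_iff]
    change _ ≤ s ω at h4
    linarith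
  · rw [not_lt_top_iff.1 h, EReal.sub_top]
    exact bot_le

section ClosedFunctions

variable [IsFiniteMeasure μ]

/-- Concatenation gives one point that is finite from above wherever some point is; the event where
it takes the value `⊤` then belongs to `eventsPI k`. -/
theorem exists_lt_top_on_BP (hE : HasCCP (μ := μ) (Set.univ : Set E)) (hk : IsLocal k) :
    ∃ y, ∀ᵐ ω ∂μ, ω ∈ BP k → k y ω < ⊤ := by
  obtain ⟨z, hz⟩ := exists_forall_ae_imp hE (fun y ω => k y ω < ⊤)
    (fun y => measurableSet_lt (k y).measurable measurable_const) (by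
      intro A hA x y hxy
      filter_upwards [hk.ae_eq hxy] with ω h hω hlt
      rwa [← h hω])
  refine ⟨z, ?_⟩
  filter_upwards [(isEssSupSet_essSupSet (μ := μ) (eventsPI k) fun _ h => h.1).subset
    {ω | k z ω = ⊤} ⟨(k z).measurable (measurableSet_singleton ⊤), fun y => by
      filter_upwards [hz y] with ω h hω
      by_contra hne
      exact (h (lt_top_iff_ne_top.2 hne)).ne hω⟩] with ω h hω
  exact lt_top_iff_ne_top.2 fun htop => hω (Or.inr (h htop))

/-- Lower semicontinuity gives height `r` near `x`, and convexity with a finite point `y₀` controls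
`k` far away. A steep enough seminorm combines both into the minorant required by
`exists_dual_conjC_le`. The event shrinks with each use of lower semicontinuity, but stays nonnull.
-/
theorem IsTcClosed.exists_dual (hP : ∀ p ∈ P, IsL0Seminorm p)
    (hE : HasCCP (μ := μ) (Set.univ : Set E)) (hk : IsTcClosed P k) {B : Set Ω}
    (hB : MeasurableSet B) (hBP : B ⊆ BP k) (hμB : 0 < μ B) (x : E) (r : L0 μ)
    (hr : ∀ᵐ ω ∂μ, ω ∈ B → ((r ω : ℝ) : EReal) < k x ω) :
    ∃ B' ⊆ B, 0 < μ B' ∧ ∃ g : DualC P,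
      ∀ᵐ ω ∂μ, ω ∈ B' → conjC P k g ω ≤ ((g.1 x ω - r ω : ℝ) : EReal) := by
  obtain ⟨y₀, hy₀⟩ := exists_lt_top_on_BP hE hk.isLocal
  have hreg : ∀ (A : Set Ω) (hA : MeasurableSet A), A ⊆ BP k → 0 < μ A →
      ConvexOnEvent k A hA ∧ LscOn P k A hA := by
    intro A hA hABP hμA
    refine hk.regular A hA hABP hμA ⟨⟨_, ⟨y₀, rfl⟩, ?_⟩, fun y _ => ?_⟩
    · filter_upwards [hy₀, hk.isLocal y₀ A hA] with ω h1 h2 hω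
      rw [← h2 hω]
      exact h1 (hABP hω)
    · filter_upwards [ae_bot_lt_on_BP k y] with ω h hω
      exact h (hABP hω)
  have hm : Measurable fun ω => (k y₀ ω).toReal := measurable_ereal_toReal.comp (k y₀).measurable
  obtain ⟨a, ha⟩ : ∃ a : L0 μ, ∀ᵐ ω ∂μ, ω ∈ BP k → k y₀ ω = ((a ω : ℝ) : EReal) := by
    refine ⟨AEEqFun.mk _ hm.aestronglyMeasurable, ?_⟩
    filter_upwards [AEEqFun.coeFn_mk _ hm.aestronglyMeasurable (μ := μ), hy₀,
      ae_bot_lt_on_BP k y₀] with ω h1 h2 h3 hω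
    rw [h1, EReal.coe_toReal (h2 hω).ne (h3 hω).ne']
  obtain ⟨q₁, hq₁, ε₁, hε₁, B₁, hB₁, hB₁m, hμB₁, hball₁⟩ :=
    exists_ball_lt hP hE hk.isLocal hB (hreg B hB hBP hμB).2 hμB x r hr
  have ha1 : ∀ᵐ ω ∂μ, (a - 1) ω = a ω - 1 := by
    filter_upwards [AEEqFun.coeFn_sub a 1, AEEqFun.coeFn_one (μ := μ) (β := ℝ)] with ω h1 h2
    rw [h1, Pi.sub_apply, h2, Pi.one_apply]
  obtain ⟨q₀, hq₀, ε₀, hε₀, B₀, hB₀, hB₀m, hμB₀, hball₀⟩ :=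
    exists_ball_lt hP hE hk.isLocal hB₁m (hreg B₁ hB₁m (hB₁.trans hBP) hμB₁).2 hμB₁ y₀ (a - 1) (by
      filter_upwards [ha, ha1] with ω h1 h2 hω
      rw [h1 (hBP (hB₁ hω)), h2, EReal.coe_lt_coe_iff]
      linarith)
  have hB₀BP : B₀ ⊆ BP k := hB₀.trans (hB₁.trans hBP)
  have hconv := (hreg B₀ hB₀m hB₀BP hμB₀).1
  have hlow := ae_le_of_convex_of_ball hk.isLocal hconv hq₀.seminorm hε₀ (a := a) (x := y₀)
    (by filter_upwards [ha] with ω h hω using h (hB₀BP hω))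
    (fun y => by
      filter_upwards [hball₀ y, ha1] with ω h1 h2 hω hle
      rw [← h2]
      exact h1 hω hle)
  -- At least the amount by which the global lower bound at `x` falls short of `r`. Outside the ball
  -- `q₁ (y - x) > ε₁`, so the term `c * pinv ε₁ * q₁` pays for it; `pinv ε₀ * q₀` pays for moving
  -- from `x` to `y`.
  set c : L0 μ := |r - (a - 1 - pinv ε₀ * q₀ (x - y₀))| with hc
  have hcω : ∀ᵐ ω ∂μ, c ω = |r ω - (a ω - 1 - (ε₀ ω)⁻¹ * q₀ (x - y₀) ω)| := by
    filter_upwards [AEEqFun.coeFn_abs (r - (a - 1 - pinv ε₀ * q₀ (x - y₀))),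
      AEEqFun.coeFn_sub r (a - 1 - pinv ε₀ * q₀ (x - y₀)),
      AEEqFun.coeFn_sub (a - 1) (pinv ε₀ * q₀ (x - y₀)), ha1,
      AEEqFun.coeFn_mul (pinv ε₀) (q₀ (x - y₀)), ae_pinv ε₀] with ω h1 h2 h3 h4 h5 h6
    rw [hc, h1, h2, Pi.sub_apply, h3, Pi.sub_apply, h4, h5, Pi.mul_apply, h6]
  have hq : IsTcSeminorm P (fun w => c * pinv ε₁ * q₁ w + pinv ε₀ * q₀ w) :=
    (hq₁.const_mul (mul_nonneg (abs_nonneg _) (pinv_nonneg hε₁.nonneg))).add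
      (hq₀.const_mul (pinv_nonneg hε₀.nonneg))
  obtain ⟨g, hg⟩ := exists_dual_conjC_le (P := P) hk.isLocal hconv hq (x := x) (y₀ := y₀) (r := r)
    (fun y => by filter_upwards [ae_bot_lt_on_BP k y] with ω h hω using h (hB₀BP hω))
    (by filter_upwards [hy₀] with ω h hω using h (hB₀BP hω))
    (fun y => by
      have htri := hq₀.seminorm.add_le (y - x) (x - y₀)
      rw [sub_add_sub_cancel] at htri
      filter_upwards [hlow y, hball₁ y, hcω, hε₁, hε₀,
        AEEqFun.coeFn_add (c * pinv ε₁ * q₁ (y - x)) (pinv ε₀ * q₀ (y - x)),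
        AEEqFun.coeFn_mul (c * pinv ε₁) (q₁ (y - x)), AEEqFun.coeFn_mul c (pinv ε₁),
        AEEqFun.coeFn_mul (pinv ε₀) (q₀ (y - x)), ae_pinv ε₀, ae_pinv ε₁,
        AEEqFun.coeFn_le.2 htri, AEEqFun.coeFn_add (q₀ (y - x)) (q₀ (x - y₀)),
        ae_nonneg (hq₁.seminorm.nonneg (y - x)), ae_nonneg (hq₀.seminorm.nonneg (y - x))]
        with ω h1 h2 h3 h4 h5 h6 h7 h8 h9 h10 h11 h12 h13 h14 h15 hω
      have hcn : 0 ≤ c ω := by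
        rw [h3]
        exact abs_nonneg _
      rw [h6, Pi.add_apply, h7, Pi.mul_apply, h8, Pi.mul_apply, h9, Pi.mul_apply, h10, h11]
      have hp1 : 0 ≤ c ω * (ε₁ ω)⁻¹ * q₁ (y - x) ω := by positivity
      have hp0 : 0 ≤ (ε₀ ω)⁻¹ * q₀ (y - x) ω := by positivity
      by_cases hle : q₁ (y - x) ω ≤ ε₁ ω
      · refine le_trans ?_ (h2 (hB₀ hω) hle).le
        rw [EReal.coe_le_coe_iff]
        linarith
      · refine le_trans ?_ (h1 hω)
        rw [EReal.coe_le_coe_iff]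
        rw [h13, Pi.add_apply] at h12
        have i1 : c ω ≤ c ω * (ε₁ ω)⁻¹ * q₁ (y - x) ω := by
          rw [mul_assoc]
          refine le_mul_of_one_le_right hcn ?_
          rw [inv_mul_eq_div, one_le_div h4]
          exact (not_le.1 hle).le
        have i2 : (ε₀ ω)⁻¹ * q₀ (y - y₀) ω ≤
            (ε₀ ω)⁻¹ * q₀ (y - x) ω + (ε₀ ω)⁻¹ * q₀ (x - y₀) ω := by
          rw [← mul_add]
          exact mul_le_mul_of_nonneg_left h12 (inv_nonneg.2 h5.le)
        have i3 := le_abs_self (r ω - (a ω - 1 - (ε₀ ω)⁻¹ * q₀ (x - y₀) ω))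
        rw [← h3] at i3
        linarith)
  exact ⟨B₀, hB₀.trans hB₁, hμB₀, g, hg⟩

/-- The Fenchel–Moreau inequality for `𝒯_c`-closed functions. -/
theorem IsTcClosed.le_biconjC (hP : ∀ p ∈ P, IsL0Seminorm p)
    (hE : HasCCP (μ := μ) (Set.univ : Set E)) (hk : IsTcClosed P k) : k ≤ biconjC P k := by
  intro x
  rw [← AEEqFun.coeFn_le]
  have hPI : ∀ᵐ ω ∂μ, ω ∈ PI k → biconjC P k x ω = ⊤ := by
    let g : DualC P := ⟨0, IsTcSeminorm.zero.continuous_of_le 0 fun _ => le_rfl⟩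
    have h := ae_conjC_le_on (P := P) (f := k) (g := g) (c := fun _ => ⊥)
      (isEssSupSet_essSupSet (μ := μ) (eventsPI k) fun _ h => h.1).measurable measurable_const
      fun y => by
        filter_upwards [ae_eq_top_on_PI k y] with ω h hω
        rw [h hω, EReal.sub_top]
    filter_upwards [h, ae_sub_le_biconjC k g x] with ω h1 h2 hω
    rw [le_bot_iff.1 (h1 hω), EReal.coe_sub_bot] at h2
    exact top_le_iff.1 h2
  -- Rational levels leave only countably many null sets, and a constant level is a legitimate `r :
  -- L0 μ`.
  have hBP : ∀ s : ℚ, ∀ᵐ ω ∂μ, ω ∈ BP k →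
      ¬ (biconjC P k x ω < ((s : ℝ) : EReal) ∧ ((s : ℝ) : EReal) < k x ω) := by
    intro s
    set B : Set Ω := BP k ∩ ({ω | biconjC P k x ω < ((s : ℝ) : EReal)} ∩
      {ω | ((s : ℝ) : EReal) < k x ω}) with hBdef
    have hB : MeasurableSet B := (measurableSet_BP k).inter
      ((measurableSet_lt (biconjC P k x).measurable measurable_const).inter
        (measurableSet_lt measurable_const (k x).measurable))
    suffices h0 : μ B = 0 by
      filter_upwards [measure_eq_zero_iff_ae_notMem.1 h0] with ω h hω hlt
      exact h ⟨hω, hlt⟩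
    by_contra hne
    have hconst := AEEqFun.coeFn_const Ω (μ := μ) (s : ℝ)
    obtain ⟨B', hB', hμB', g, hg⟩ := hk.exists_dual hP hE hB Set.inter_subset_left
      (pos_iff_ne_zero.2 hne) x (AEEqFun.const Ω (s : ℝ)) (by
        filter_upwards [hconst] with ω h hω
        rw [h]
        exact hω.2.2)
    refine hμB'.ne' (measure_eq_zero_iff_ae_notMem.2 ?_)
    filter_upwards [hg, hconst, ae_sub_le_biconjC k g x] with ω h1 h2 h3 hω
    refine absurd (hB' hω).2.1 (not_lt.2 (le_trans ?_ h3))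
    refine le_trans (le_of_eq ?_) (EReal.sub_le_sub le_rfl (h1 hω))
    rw [h2, EReal.coe_sub, coe_sub_coe_sub_cancel]
    rfl
  filter_upwards [hk.eq_bot x, hPI, ae_all_iff.2 hBP] with ω h1 h2 h3
  by_cases hMI : ω ∈ MI k
  · rw [h1 hMI]
    exact bot_le
  by_cases hPI' : ω ∈ PI k
  · rw [h2 hPI']
    exact le_top
  by_contra hcon
  obtain ⟨s, hs⟩ := EReal.lt_iff_exists_rat_btwn.1 (not_le.1 hcon)
  exact h3 s (fun h => h.elim hMI hPI') hs

end ClosedFunctions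

end FenchelMoreau

end RandomConvex

end

theorem corollary5p15 {Ω : Type*} [MeasurableSpace Ω] (μ : MeasureTheory.Measure Ω)
    [MeasureTheory.IsProbabilityMeasure μ] {E : Type*} [AddCommGroup E]
    [Module (MeasureTheory.AEEqFun Ω ℝ μ) E] (P : Set (E → RandomConvex.L0 μ))
    (hP : RandomConvex.IsRLCModule P)
    (hE : RandomConvex.HasCCP (μ := μ) (Set.univ : Set E))
    (f : E → RandomConvex.LBar0 μ) (hf : RandomConvex.IsLocal f) :
    RandomConvex.IsClosureC P f (RandomConvex.biconjC P f) :=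
  ⟨⟨RandomConvex.biconjC_isTcClosed P f, RandomConvex.biconjC_le P f⟩, fun _ hk =>
    (hk.1.le_biconjC hP.seminorm hE).trans (RandomConvex.biconjC_mono hk.2)⟩
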